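/- Let $1<p<\infty$, let $k\ge 1$ be an integer, and let $\{e_n\}_{n=1}^\infty$ be a symmetric basis of the complex sequence space $\ell_p$, i.e. a Schauder basis each of whose permutations $\{e_{\sigma(n)}\}$ is a Schauder basis equivalent to $\{e_n\}$ (for every scalar sequence $(a_n)$, $\sum a_n e_n$ converges if and only if $\sum a_n e_{\sigma(n)}$ converges). For a complex sequence $c=(c_n)_{n\ge1}$ put $(\Delta c)_n=c_n-c_{n-1}$ with $c_0=0$. Let $\ell_{p,k}(\{e_n\})$ be the space of formal series $x=(\mathfrak f)\sum_{n=1}^\infty c_n e_n$ for which $\sum_{n=1}^\infty(\Delta^k c)_n e_n$ converges in $\ell_p$, with norm $$\|x\|_k=\Bigl\|\sum_{n=1}^\infty(\Delta^k c)_n e_n\Bigr\|.$$ Let $f_k:[1,\infty)\to\mathbb R$ belong to the class $\mathcal S_k$, i.e. $\lim_{x\to\infty}f_k(x)=+\infty$ and, for each $j=1,\dots,k$, the limit $\lim_{n\to\infty}n^k|f_k(n-j)-f_k(n)|$ exists and is finite. Define $$A_k\,(\mathfrak f)\sum_{n=1}^\infty c_n e_n=(\mathfrak f)\sum_{n=1}^\infty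 i f_k(n)\,c_n e_n,\qquad D(A_k)=\Bigl\{(\mathfrak f)\sum_{n=1}^\infty c_n e_n\in\ell_{p,k}(\{e_n\}):\ (\mathfrak f)\sum_{n=1}^\infty f_k(n)c_n e_n\in\ell_{p,k}(\{e_n\})\Bigr\}.$$ Then $A_k$ generates on $\ell_{p,k}(\{e_n\})$ the $C_0$-group $$e^{A_k t}\,(\mathfrak f)\sum_{n=1}^\infty c_n e_n=(\mathfrak f)\sum_{n=1}^\infty e^{itf_k(n)}c_n e_n,\qquad t\in\mathbb R,$$ and its growth bound $\omega_{0,k}=\inf\{w\in\mathbb R:\ \exists M\ \forall t\ge0\ \ \|e^{A_kt}\|\le Me^{wt}\}$ and the spectral bound $s(A_k)=\sup\{\operatorname{Re}\lambda:\ \lambda\in\sigma(A_k)\}$ of its generator satisfy $$\omega_{0,k}=s(A_k)=0.$$ -/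

import Mathlib

open Filter Topology
open scoped ENNReal

noncomputable section

/-! ### Symmetric bases -/

section SymmetricBases

variable {X : Type*} [NormedAddCommGroup X] [NormedSpace ℂ X]

/-- Two Schauder bases `b`, `b'` are equivalent: for every scalar sequence `a`, the series
`∑ aₙ bₙ` converges (in the order of the indices) if and only if `∑ aₙ b'ₙ` converges. -/
def EquivalentBases (b b' : SchauderBasis ℂ X) : Prop :=
  ∀ a : ℕ → ℂ,
    Summable (fun n => a n • b n) (SummationFilter.conditional ℕ) ↔
      Summable (fun n => a n • b' n) (SummationFilter.conditional ℕ)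

/-- A Schauder basis is symmetric if each of its permutations is a Schauder basis which is
equivalent to the original one. -/
def IsSymmetricBasis (b : SchauderBasis ℂ X) : Prop :=
  ∀ σ : Equiv.Perm ℕ, ∃ b' : SchauderBasis ℂ X,
    (∀ n, b' n = b (σ n)) ∧ EquivalentBases b b'

end SymmetricBases

/-! ### The difference operator -/

/-- The backward difference `(Δ c)ₙ = cₙ - cₙ₋₁` on complex sequences, where the entry that
precedes the first one is `0`. -/
def backwardDiff : (ℕ → ℂ) →ₗ[ℂ] (ℕ → ℂ) where
  toFun c n := c n - if n = 0 then 0 else c (n - 1)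
  map_add' c d := by
    funext n
    by_cases h : n = 0
    · simp [h]
    · simp only [Pi.add_apply, if_neg h]
      ring
  map_smul' a c := by
    funext n
    by_cases h : n = 0
    · simp [h]
    · simp only [Pi.smul_apply, smul_eq_mul, if_neg h, RingHom.id_apply]
      ring

theorem backwardDiff_injective : Function.Injective backwardDiff := by
  rw [injective_iff_map_eq_zero]
  intro c hc
  funext n
  induction n with
  | zero => simpa [backwardDiff] using congrFun hc 0
  | succ n ih => simpa [backwardDiff, ih] using congrFun hc (n + 1)

theorem backwardDiff_pow_injective (k : ℕ) : Function.Injective (backwardDiff ^ k) := by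
  rw [Module.End.coe_pow]
  exact backwardDiff_injective.iterate k

/-! ### The space of formal series `(𝔣) ∑ cₙ eₙ` -/

section FormalSeries

variable {X : Type*} [NormedAddCommGroup X] [NormedSpace ℂ X]

/-- The sequences `c` for which the series `∑ (Δᵏ c)ₙ eₙ` converges in `X`. -/
def formalSubmodule (b : SchauderBasis ℂ X) (k : ℕ) : Submodule ℂ (ℕ → ℂ) where
  carrier := {c | Summable (fun n => (backwardDiff ^ k) c n • b n) (SummationFilter.conditional ℕ)}
  zero_mem' := by
    simp [summable_zero]
  add_mem' {c d} hc hd := by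
    simpa [add_smul] using Summable.add hc hd
  smul_mem' a c hc := by
    simpa [mul_smul] using Summable.const_smul a hc

/-- The space of formal series `(𝔣) ∑ cₙ eₙ` such that `∑ (Δᵏ c)ₙ eₙ` converges in `X`;
a formal series is represented by its sequence of coefficients.  (This is a type of its own because
it carries the norm `‖x‖ₖ` and not the topology of coordinatewise convergence.) -/
def FormalSpace (b : SchauderBasis ℂ X) (k : ℕ) : Type := formalSubmodule b k

namespace FormalSpace

variable (b : SchauderBasis ℂ X) (k : ℕ)

instance : AddCommGroup (FormalSpace b k) := inferInstanceAs (AddCommGroup (formalSubmodule b k))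

instance : Module ℂ (FormalSpace b k) := inferInstanceAs (Module ℂ (formalSubmodule b k))

/-- The sequence of coefficients of a formal series. -/
def coeff : FormalSpace b k →ₗ[ℂ] (ℕ → ℂ) := (formalSubmodule b k).subtype

theorem summable (x : FormalSpace b k) :
    Summable (fun n => (backwardDiff ^ k) (coeff b k x) n • b n) (SummationFilter.conditional ℕ) :=
  x.2

/-- The map `(𝔣) ∑ cₙ eₙ ↦ ∑ (Δᵏ c)ₙ eₙ` into `X`, that is, the extension of `(I - T)ᵏ`, where
`T` is the right shift `T eₙ = eₙ₊₁`. -/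
def toSum : FormalSpace b k →ₗ[ℂ] X where
  toFun x := ∑'[SummationFilter.conditional ℕ] n, (backwardDiff ^ k) (coeff b k x) n • b n
  map_add' x y := by
    rw [← (summable b k x).tsum_add (summable b k y)]
    simp [add_smul]
  map_smul' a x := by
    rw [RingHom.id_apply, ← (summable b k x).tsum_const_smul a]
    simp [mul_smul]

theorem toSum_injective : Function.Injective (toSum b k) := by
  rw [injective_iff_map_eq_zero]
  intro x hx
  have hs : HasSum (fun n => (backwardDiff ^ k) (coeff b k x) n • b n) 0
      (SummationFilter.conditional ℕ) := by
    have h := (summable b k x).hasSum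
    rwa [show (∑'[SummationFilter.conditional ℕ] n, (backwardDiff ^ k) (coeff b k x) n • b n) = 0
      from hx] at h
  have hz : (backwardDiff ^ k) (coeff b k x) = 0 := by
    funext m
    have h := hs.mapL (b.coord m)
    have h2 : HasSum (fun n => b.coord m ((backwardDiff ^ k) (coeff b k x) n • b n))
        ((backwardDiff ^ k) (coeff b k x) m) (SummationFilter.conditional ℕ) := by
      have h3 := hasSum_single (L := SummationFilter.conditional ℕ)
        (f := fun n => b.coord m ((backwardDiff ^ k) (coeff b k x) n • b n)) m
        (fun n hn => by simp [b.ortho, hn.symm])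
      simpa [b.ortho] using h3
    simpa using h2.unique h
  have hc : coeff b k x = 0 := backwardDiff_pow_injective k (by rw [hz, map_zero])
  exact Subtype.ext hc

/-- The norm `‖(𝔣) ∑ cₙ eₙ‖ₖ = ‖∑ (Δᵏ c)ₙ eₙ‖`. -/
instance : NormedAddCommGroup (FormalSpace b k) :=
  NormedAddCommGroup.induced (FormalSpace b k) X (toSum b k) (toSum_injective b k)

instance : NormedSpace ℂ (FormalSpace b k) :=
  NormedSpace.induced ℂ (FormalSpace b k) X (toSum b k)

theorem norm_def (x : FormalSpace b k) :
    ‖x‖ = ‖∑'[SummationFilter.conditional ℕ] n, (backwardDiff ^ k) (coeff b k x) n • b n‖ :=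
  rfl

/-- The operator `(𝔣) ∑ cₙ eₙ ↦ (𝔣) ∑ i f(n) cₙ eₙ` with its maximal domain, the set of those
formal series of the space for which `(𝔣) ∑ f(n) cₙ eₙ` is in the space as well.  The entry with
index `n : ℕ` of a sequence is the `(n+1)`-st one, hence the argument `n + 1`. -/
def multOp (f : ℝ → ℝ) : FormalSpace b k →ₗ.[ℂ] FormalSpace b k where
  domain :=
    { carrier := {x | (fun n : ℕ => (f (n + 1) : ℂ) * coeff b k x n) ∈ formalSubmodule b k}
      zero_mem' := by
        have h0 : (fun n : ℕ => (f (n + 1) : ℂ) * coeff b k 0 n) = 0 := by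
          funext n
          simp
        change (fun n : ℕ => (f (n + 1) : ℂ) * coeff b k 0 n) ∈ formalSubmodule b k
        rw [h0]
        exact (formalSubmodule b k).zero_mem
      add_mem' := by
        intro x y hx hy
        simpa [mul_add] using! (formalSubmodule b k).add_mem hx hy
      smul_mem' := by
        intro a x hx
        simpa [mul_left_comm] using! (formalSubmodule b k).smul_mem a hx }
  toFun :=
    { toFun x := (⟨Complex.I • fun n : ℕ => (f (n + 1) : ℂ) * coeff b k x.1 n,
        (formalSubmodule b k).smul_mem _ x.2⟩ : formalSubmodule b k)
      map_add' := by
        intro x y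
        apply Subtype.ext
        funext n
        change Complex.I * (_ * (coeff b k (x.1 + y.1) n)) = Complex.I * _ + Complex.I * _
        rw [map_add, Pi.add_apply]
        ring
      map_smul' := by
        intro a x
        apply Subtype.ext
        funext n
        change Complex.I * (_ * (coeff b k (a • x.1) n)) = a * (Complex.I * _)
        rw [map_smul, Pi.smul_apply, smul_eq_mul]
        ring }

theorem mem_multOp_domain (f : ℝ → ℝ) (x : FormalSpace b k) :
    x ∈ (multOp b k f).domain ↔
      Summable (fun n => (backwardDiff ^ k) (fun m : ℕ => (f (m + 1) : ℂ) * coeff b k x m) n • b n)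
        (SummationFilter.conditional ℕ) :=
  Iff.rfl

theorem coeff_multOp (f : ℝ → ℝ) (x : (multOp b k f).domain) (n : ℕ) :
    coeff b k (multOp b k f x) n = Complex.I * f (n + 1) * coeff b k x n :=
  (mul_assoc _ _ _).symm

end FormalSpace

end FormalSeries

/-! ### The function classes -/

/-- The class `𝒮ₖ`: `f(x) → +∞` as `x → ∞`, and for each `j = 1, …, k` the sequence
`nᵏ |f(n - j) - f(n)|` has a finite limit.  Only the values of `f` on `[1, ∞)` matter. -/
def IsClassS (k : ℕ) (f : ℝ → ℝ) : Prop :=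
  Tendsto f atTop atTop ∧
    ∀ j : ℕ, 1 ≤ j → j ≤ k →
      ∃ l : ℝ, Tendsto (fun n : ℕ => (n : ℝ) ^ k * |f ((n : ℝ) - j) - f n|) atTop (𝓝 l)

/-! ### Groups of operators, generators, growth bound and spectral bound -/

section Groups

/-- A `C₀`-group (strongly continuous one-parameter group) of bounded operators. -/
structure C0Group (Y : Type*) [NormedAddCommGroup Y] [NormedSpace ℂ Y] where
  /-- The operator at time `t`. -/
  op : ℝ → Y →L[ℂ] Y
  op_zero : op 0 = ContinuousLinearMap.id ℂ Y
  op_add : ∀ s t : ℝ, op (s + t) = (op s).comp (op t)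
  continuous_orbit : ∀ y : Y, Continuous fun t : ℝ => op t y

variable {Y : Type*} [NormedAddCommGroup Y] [NormedSpace ℂ Y]

/-- `A` is the generator of `U`: the domain of `A` consists of exactly those `x` for which
`(U(h)x - x)/h` has a limit as `h → 0`, and `A x` is this limit. -/
def C0Group.HasGenerator (U : C0Group Y) (A : Y →ₗ.[ℂ] Y) : Prop :=
  ∀ x y : Y, (x, y) ∈ A.graph ↔
    Tendsto (fun h : ℝ => (h : ℂ)⁻¹ • (U.op h x - x)) (𝓝[≠] 0) (𝓝 y)

/-- The growth bound: the infimum, in the extended reals, of all real `w` for which there is `M`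
with `‖U(t)‖ ≤ M exp(w t)` for all `t ≥ 0`. -/
def C0Group.growthBound (U : C0Group Y) : EReal :=
  sInf ((fun w : ℝ => (w : EReal)) ''
    {w : ℝ | ∃ M : ℝ, ∀ t : ℝ, 0 ≤ t → ‖U.op t‖ ≤ M * Real.exp (w * t)})

/-- The resolvent set of an unbounded operator: all `z` for which `z - A : D(A) → Y` has an
everywhere defined bounded two-sided inverse `R`. -/
def unboundedResolventSet (A : Y →ₗ.[ℂ] Y) : Set ℂ :=
  {z | ∃ R : Y →L[ℂ] Y,
    (∀ y : Y, ∃ h : R y ∈ A.domain, z • R y - A ⟨R y, h⟩ = y) ∧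
      ∀ x : A.domain, R (z • (x : Y) - A x) = x}

/-- The spectrum of an unbounded operator. -/
def unboundedSpectrum (A : Y →ₗ.[ℂ] Y) : Set ℂ := (unboundedResolventSet A)ᶜ

/-- The spectral bound `s(A) = sup {Re z : z ∈ σ(A)}`, in the extended reals. -/
def spectralBound (A : Y →ₗ.[ℂ] Y) : EReal :=
  sSup ((fun z : ℂ => (z.re : EReal)) '' unboundedSpectrum A)

end Groups

end

/-! The problem reduces to multipliers on `ℓ_p`. A symmetric basis of `ℓ_p`, `1 < p < ∞`, is
equivalent to the unit vector basis. Indeed, it is bounded above and below in norm, so a subsequence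
converges coordinatewise to some `y ∈ ℓ_p`, and by a gliding hump a further subsequence of `e_{φ(j)}
- y` is almost disjointly supported. The series `∑ (e_{φ(j)} - y)/(j+1)` then converges. Each
coordinate functional sees at most one `e_{φ(j)}`, while the harmonic series diverges; hence `y =
0`, and a subsequence is equivalent to the unit vectors. Symmetry carries this over to the even and
the odd indices, hence to the whole basis. Thus `c ↦ Δᵏ c` identifies the space of formal series
with `ℓ_p`.

The analytic core is `lp.exists_multiplier_bound`. Freezing `m` at `mₙ` gives `Δᵏ(mc)ₙ = mₙ(Δᵏc)ₙ +
Δᵏ((m - mₙ)c)ₙ`. Since `c` is a `k`-fold partial sum of `Δᵏ c`, Hardy's inequality applied `k` times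
gives `|cⱼ| ≤ (n+1)ᵏ hₙ` for `j ≤ n`, with `h ∈ ℓ_p` controlled by `Δᵏ c`. This growth is exactly
cancelled by a variation of `m` of order `n⁻ᵏ`.

For `m = e^{itf}` the variation is at most `|t|` times that of `f`, so the group grows at most
linearly and its growth bound is at most `0`; unimodularity of the multipliers gives the reverse
inequality. For `Re z ≠ 0` the sequence `(z - if)⁻¹` is also a multiplier, so the spectrum lies on
the imaginary axis, and it contains the eigenvalues `if(n)`. -/

noncomputable section

/-! ### Rearrangements and unconditional convergence. -/

theorem summable_conditional_iff_tendsto {X : Type*} [NormedAddCommGroup X] {g : ℕ → X} :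
    Summable g (SummationFilter.conditional ℕ) ↔
      ∃ x, Tendsto (fun n => ∑ i ∈ Finset.range n, g i) atTop (𝓝 x) := by
  simp only [Summable, HasSum, SummationFilter.conditional_filter_eq_map_range, tendsto_map'_iff]
  rfl

theorem Summable.conditional {X : Type*} [NormedAddCommGroup X] {g : ℕ → X} (hg : Summable g) :
    Summable g (SummationFilter.conditional ℕ) :=
  summable_conditional_iff_tendsto.2 ⟨_, hg.hasSum.tendsto_sum_nat⟩

/-- A strictly increasing sequence that starts at `0` cuts `ℕ` into consecutive blocks. -/
theorem StrictMono.exists_blockIndex {N : ℕ → ℕ} (hN : StrictMono N) (h0 : N 0 = 0) :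
    ∃ f : ℕ → ℕ, ∀ n i, f n = i ↔ N i ≤ n ∧ n < N (i + 1) := by
  have hex : ∀ n, ∃ i, N i ≤ n ∧ n < N (i + 1) := by
    intro n
    have h : ∃ i, n < N (i + 1) := ⟨n, lt_of_lt_of_le (Nat.lt_succ_self n) hN.le_apply⟩
    classical
    refine ⟨Nat.find h, ?_, Nat.find_spec h⟩
    rcases hi : Nat.find h with _ | i
    · simp [h0]
    · have := Nat.find_min h (m := i) (by omega)
      omega
  choose f hf using hex
  refine ⟨f, fun n i => ⟨fun h => h ▸ hf n, fun h => ?_⟩⟩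
  have h1 : f n < i + 1 := hN.lt_iff_lt.1 ((hf n).1.trans_lt h.2)
  have h2 : i < f n + 1 := hN.lt_iff_lt.1 (h.1.trans_lt (hf n).2)
  omega

/-- Given consecutive blocks of natural numbers and a subset of each, there is a permutation of `ℕ`
which lists, in each block, the elements of the subset first. -/
theorem exists_perm_image_Ico {N : ℕ → ℕ} (hN : StrictMono N) (h0 : N 0 = 0)
    {t : ℕ → Finset ℕ} (ht : ∀ i, t i ⊆ Finset.Ico (N i) (N (i + 1))) :
    ∃ σ : Equiv.Perm ℕ, ∀ i,
      (Finset.Ico (N i) (N i + (t i).card)).image σ = t i := by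
  classical
  obtain ⟨f, hf⟩ := hN.exists_blockIndex h0
  have hcard : ∀ i, N i + (t i).card ≤ N (i + 1) := by
    intro i
    have h1 := Finset.card_le_card (ht i)
    rw [Nat.card_Ico] at h1
    have := hN.monotone (Nat.le_succ i)
    simp only [Nat.succ_eq_add_one] at this
    omega
  have hblock : ∀ i, ∃ τ : Equiv.Perm {n // f n = i},
      ∀ x : {n // f n = i}, (x : ℕ) < N i + (t i).card → ((τ x : {n // f n = i}) : ℕ) ∈ t i := by
    intro i
    have hfin : Finite {n // f n = i} :=
      Set.Finite.to_subtype ((Set.finite_Iio (N (i + 1))).subset fun n hn => ((hf n i).1 hn).2)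
    have := Fintype.ofFinite {n // f n = i}
    let A : {n // f n = i} → Prop := fun x => (x : ℕ) < N i + (t i).card
    let B : {n // f n = i} → Prop := fun x => (x : ℕ) ∈ t i
    let eA : {x // A x} ≃ Finset.Ico (N i) (N i + (t i).card) :=
      { toFun x := ⟨x.1.1, Finset.mem_Ico.2 ⟨((hf _ _).1 x.1.2).1, x.2⟩⟩
        invFun y := ⟨⟨y.1, (hf _ _).2 ⟨(Finset.mem_Ico.1 y.2).1,
          (Finset.mem_Ico.1 y.2).2.trans_le (hcard i)⟩⟩, (Finset.mem_Ico.1 y.2).2⟩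
        left_inv x := rfl
        right_inv y := rfl }
    let eB : {x // B x} ≃ t i :=
      { toFun x := ⟨x.1.1, x.2⟩
        invFun y := ⟨⟨y.1, (hf _ _).2 (Finset.mem_Ico.1 (ht i y.2))⟩, y.2⟩
        left_inv x := rfl
        right_inv y := rfl }
    have hc : (Finset.Ico (N i) (N i + (t i).card)).card = (t i).card := by simp
    let e : {x // A x} ≃ {x // B x} := eA.trans ((Finset.equivOfCardEq hc).trans eB.symm)
    exact ⟨e.extendSubtype, fun x hx => e.extendSubtype_mem x hx⟩
  choose τ hτ using hblock
  -- The blocks are the fibres of `f`, so the permutations `τ i` of the single blocks glue to one of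
  -- `ℕ`.
  let σ : Equiv.Perm ℕ :=
    ((Equiv.sigmaFiberEquiv f).symm.trans (Equiv.sigmaCongrRight τ)).trans (Equiv.sigmaFiberEquiv f)
  refine ⟨σ, fun i => Finset.eq_of_subset_of_card_le ?_ ?_⟩
  · intro m hm
    obtain ⟨n, hn, rfl⟩ := Finset.mem_image.1 hm
    rw [Finset.mem_Ico] at hn
    have hfn : f n = i := (hf n i).2 ⟨hn.1, hn.2.trans_le (hcard i)⟩
    subst hfn
    exact hτ (f n) ⟨n, rfl⟩ hn.2
  · rw [Finset.card_image_of_injective _ σ.injective]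
    simp

/-- In a Banach space, if each rearrangement of a series converges then the series is
(unconditionally) summable. -/
theorem summable_of_forall_perm {X : Type*} [NormedAddCommGroup X] [CompleteSpace X] {g : ℕ → X}
    (hg : ∀ σ : Equiv.Perm ℕ, Summable (fun n => g (σ n)) (SummationFilter.conditional ℕ)) :
    Summable g := by
  classical
  by_contra hns
  rw [summable_iff_vanishing_norm] at hns
  push Not at hns
  obtain ⟨ε, hε, hs⟩ := hns
  have hstep : ∀ n : ℕ, ∃ t : Finset ℕ, ∃ m, n < m ∧ t ⊆ Finset.Ico n m ∧ ε ≤ ‖∑ i ∈ t, g i‖ := by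
    intro n
    obtain ⟨t, ht, hle⟩ := hs (Finset.range n)
    refine ⟨t, n + t.sup id + 1, by omega, fun i hi => ?_, hle⟩
    have h1 : i ≤ t.sup id := Finset.le_sup (f := id) hi
    have h2 : ¬ i < n := fun h => Finset.disjoint_left.1 ht hi (Finset.mem_range.2 h)
    rw [Finset.mem_Ico]
    omega
  choose t m hm ht hle using hstep
  let N : ℕ → ℕ := fun i => Nat.rec 0 (fun _ n => m n) i
  have hN : StrictMono N := strictMono_nat_of_lt_succ fun i => hm (N i)
  -- With the bad set of each block listed first, the partial sums at `N i` and `N i + card` differ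
  -- by a sum of norm at least `ε`: this rearrangement is not Cauchy.
  obtain ⟨σ, hσ⟩ := exists_perm_image_Ico hN rfl (t := fun i => t (N i)) fun i => ht (N i)
  obtain ⟨x, hx⟩ := summable_conditional_iff_tendsto.1 (hg σ)
  have h1 := hx.comp hN.tendsto_atTop
  have h2 : Tendsto (fun i => N i + (t (N i)).card) atTop atTop :=
    tendsto_atTop_mono (fun i => Nat.le_add_right _ _) hN.tendsto_atTop
  have h3 := (hx.comp h2).sub h1
  rw [sub_self] at h3
  have h4 : ∀ i, ε ≤ ‖((fun n => ∑ i ∈ Finset.range n, g (σ i)) ∘ fun i => N i + (t (N i)).card) i -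
      ((fun n => ∑ i ∈ Finset.range n, g (σ i)) ∘ N) i‖ := by
    intro i
    simp only [Function.comp]
    rw [← Finset.sum_Ico_eq_sub _ (Nat.le_add_right _ _),
      ← Finset.sum_image (f := g) (g := σ) (fun a _ b _ h => σ.injective h), hσ i]
    exact hle (N i)
  have h5 := h3.norm
  rw [norm_zero] at h5
  exact absurd (ge_of_tendsto' h5 h4) (not_le.2 hε)

/-- Two injections of `ℕ` into itself with infinite complements of their ranges differ by a
permutation. -/
theorem exists_perm_comp_eq {φ ψ : ℕ → ℕ} (hφ : φ.Injective) (hψ : ψ.Injective)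
    (hφc : (Set.range φ)ᶜ.Infinite) (hψc : (Set.range ψ)ᶜ.Infinite) :
    ∃ σ : Equiv.Perm ℕ, ∀ n, σ (φ n) = ψ n := by
  classical
  have := hφc.to_subtype
  have := hψc.to_subtype
  obtain ⟨e⟩ : Nonempty (((Set.range φ)ᶜ : Set ℕ) ≃ ((Set.range ψ)ᶜ : Set ℕ)) :=
    nonempty_equiv_of_countable
  let e' : {x // x ∈ Set.range φ} ≃ {x // x ∈ Set.range ψ} :=
    (Equiv.ofInjective φ hφ).symm.trans (Equiv.ofInjective ψ hψ)
  refine ⟨Equiv.subtypeCongr e' e, fun n => ?_⟩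
  have h : φ n ∈ Set.range φ := ⟨n, rfl⟩
  simp only [Equiv.subtypeCongr, Equiv.trans_apply]
  rw [Equiv.sumCompl_symm_apply_of_pos h]
  have h' : (Equiv.ofInjective φ hφ).symm ⟨φ n, h⟩ = n := Equiv.ofInjective_symm_apply hφ n
  change ((Equiv.ofInjective ψ hψ ((Equiv.ofInjective φ hφ).symm ⟨φ n, h⟩) : Set.range ψ) : ℕ) = ψ n
  rw [h']
  rfl

/-! ### Symmetric bases: unconditionality, transport along injections, norm bounds. -/

section Symmetric

variable {X : Type*} [NormedAddCommGroup X] [NormedSpace ℂ X]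

theorem SchauderBasis.coord_eq_of_hasSum (b : SchauderBasis ℂ X) {a : ℕ → ℂ} {x : X}
    (h : HasSum (fun n => a n • b n) x (SummationFilter.conditional ℕ)) (m : ℕ) :
    b.coord m x = a m := by
  have h1 := h.mapL (b.coord m)
  have h2 : HasSum (fun n => b.coord m (a n • b n)) (a m) (SummationFilter.conditional ℕ) := by
    have h3 := hasSum_single (L := SummationFilter.conditional ℕ)
      (f := fun n => b.coord m (a n • b n)) m (fun n hn => by simp [b.ortho, hn.symm])
    simpa [b.ortho] using h3
  exact h1.unique h2

/-- Series in a symmetric basis converge unconditionally. -/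
theorem IsSymmetricBasis.summable [CompleteSpace X] {b : SchauderBasis ℂ X}
    (hb : IsSymmetricBasis b) (σ : Equiv.Perm ℕ) {a : ℕ → ℂ}
    (h : Summable (fun n => a n • b (σ n)) (SummationFilter.conditional ℕ)) :
    Summable fun n => a n • b (σ n) := by
  apply summable_of_forall_perm
  intro τ
  obtain ⟨b', hb', -⟩ := hb σ
  obtain ⟨b'', hb'', -⟩ := hb (τ.trans σ)
  obtain ⟨x, hx⟩ := h
  have h1 := b''.expansion x
  -- The permutation `σ ∘ τ` also yields a Schauder basis, and the expansion of the same sum `x` in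
  -- it is the rearranged series.
  have h2 : ∀ n, b''.coord n x = a (τ n) := by
    intro n
    have h3 := hx.mapL (b''.coord n)
    have h4 : HasSum (fun j => b''.coord n (a j • b (σ j))) (a (τ n))
        (SummationFilter.conditional ℕ) := by
      have hj : ∀ j, b''.coord n (b (σ j)) = if j = τ n then 1 else 0 := by
        intro j
        have h6 := b''.ortho n (τ.symm j)
        rw [hb'' (τ.symm j)] at h6
        simp only [Equiv.trans_apply, Equiv.apply_symm_apply] at h6
        rw [h6]
        split_ifs with hjn
        · simp [hjn]
        · have hn : n ≠ τ.symm j := fun hn => hjn (by rw [hn, Equiv.apply_symm_apply])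
          simp [hn]
      have h5 := hasSum_single (L := SummationFilter.conditional ℕ)
        (f := fun j => b''.coord n (a j • b (σ j))) (τ n) (fun j hjn => by simp [hj, hjn])
      simpa [hj] using h5
    exact h3.unique h4
  refine ⟨x, ?_⟩
  convert h1 using 2 with n
  rw [h2, hb'']
  rfl

theorem IsSymmetricBasis.summable_iff_conditional [CompleteSpace X] {b : SchauderBasis ℂ X}
    (hb : IsSymmetricBasis b) {a : ℕ → ℂ} :
    Summable (fun n => a n • b n) (SummationFilter.conditional ℕ) ↔ Summable fun n => a n • b n :=
  ⟨fun h => hb.summable 1 h, fun h => h.conditional⟩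

theorem IsSymmetricBasis.summable_perm [CompleteSpace X] {b : SchauderBasis ℂ X}
    (hb : IsSymmetricBasis b) (σ : Equiv.Perm ℕ) {a : ℕ → ℂ} (h : Summable fun n => a n • b n) :
    Summable fun n => a n • b (σ n) := by
  obtain ⟨b', hb', he⟩ := hb σ
  apply hb.summable σ
  have := (he a).1 h.conditional
  simpa only [hb'] using this

/-- The summability of `∑ aⱼ e_{φ(j)}` does not depend on `φ`, as long as the complement of the range
of the injection `φ` is infinite. -/
theorem IsSymmetricBasis.summable_transport [CompleteSpace X] {b : SchauderBasis ℂ X}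
    (hb : IsSymmetricBasis b) {φ ψ : ℕ → ℕ} (hφ : φ.Injective) (hψ : ψ.Injective)
    (hφc : (Set.range φ)ᶜ.Infinite) (hψc : (Set.range ψ)ᶜ.Infinite) {a : ℕ → ℂ}
    (h : Summable fun j => a j • b (φ j)) : Summable fun j => a j • b (ψ j) := by
  obtain ⟨σ, hσ⟩ := exists_perm_comp_eq hφ hψ hφc hψc
  -- Padding by zeros turns the series into one over the whole basis, to which `σ`, with `σ (φ n) =
  -- ψ n`, can be applied.
  have h1 : Summable fun n => Function.extend φ a 0 n • b n := by
    rw [← hφ.summable_iff]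
    · simpa [Function.comp_def, hφ.extend_apply] using h
    · intro n hn
      simp [Function.extend_apply' _ _ _ (fun ⟨j, hj⟩ => hn ⟨j, hj⟩)]
  have h2 := (hb.summable_perm σ h1).comp_injective hφ
  simpa [Function.comp_def, hφ.extend_apply, hσ] using h2

/-- The odd indices remain unused. Passing to even indices thus secures the infinite complement that
`IsSymmetricBasis.summable_transport` requires. -/
theorem infinite_compl_range_comp_two_mul {φ : ℕ → ℕ} (hφ : φ.Injective) :
    (Set.range fun j => φ (2 * j))ᶜ.Infinite := by
  have h : (Set.range fun j => φ (2 * j + 1)) ⊆ (Set.range fun j => φ (2 * j))ᶜ := by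
    rintro _ ⟨i, rfl⟩ ⟨j, hj⟩
    have := hφ hj
    omega
  exact (Set.infinite_range_of_injective (fun i j hij => by have := hφ hij; omega)).mono h

theorem SchauderBasis.norm_pos (b : SchauderBasis ℂ X) (n : ℕ) : 0 < ‖b n‖ := by
  rw [norm_pos_iff]
  intro h
  have := b.ortho n n
  rw [h] at this
  simp at this

/-- With coefficients `‖b (ψ (2j))‖⁻¹` the series along `φ` is dominated by a geometric one, while
the series along `ψ` has terms of norm `1`. Transport makes both converge, a contradiction. -/
theorem IsSymmetricBasis.not_norm_le_pow_mul [CompleteSpace X] {b : SchauderBasis ℂ X}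
    (hb : IsSymmetricBasis b) {φ ψ : ℕ → ℕ} (hφ : φ.Injective) (hψ : ψ.Injective)
    (hle : ∀ j, ‖b (φ j)‖ ≤ (1 / 2 : ℝ) ^ j * ‖b (ψ j)‖) : False := by
  have h2 : Function.Injective fun j : ℕ => 2 * j := fun i j h => by simpa using h
  have h1 : Summable fun j => ((‖b (ψ (2 * j))‖⁻¹ : ℝ) : ℂ) • b (φ (2 * j)) := by
    apply Summable.of_norm_bounded (g := fun j => (1 / 2 : ℝ) ^ j) summable_geometric_two
    intro j
    rw [norm_smul, Complex.norm_real, norm_inv, norm_norm, inv_mul_le_iff₀ (b.norm_pos _)]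
    calc _ ≤ (1 / 2 : ℝ) ^ (2 * j) * ‖b (ψ (2 * j))‖ := hle _
      _ ≤ (1 / 2 : ℝ) ^ j * ‖b (ψ (2 * j))‖ := by
        gcongr ?_ * _
        exact pow_le_pow_of_le_one (by norm_num) (by norm_num) (by omega)
      _ = _ := mul_comm _ _
  have h3 := hb.summable_transport (hφ.comp h2) (hψ.comp h2) (infinite_compl_range_comp_two_mul hφ)
    (infinite_compl_range_comp_two_mul hψ) h1
  have h4 := h3.tendsto_atTop_zero.norm
  have h5 : (fun j => ‖((‖b (ψ (2 * j))‖⁻¹ : ℝ) : ℂ) • b (ψ (2 * j))‖) = fun _ => 1 := by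
    funext j
    rw [norm_smul, Complex.norm_real, norm_inv, norm_norm, inv_mul_cancel₀ (b.norm_pos _).ne']
  have h6 : Tendsto (fun _ : ℕ => (1 : ℝ)) atTop (𝓝 ‖(0 : X)‖) := h5 ▸ h4
  rw [norm_zero] at h6
  exact one_ne_zero (tendsto_nhds_unique tendsto_const_nhds h6)

/-- If `P j` holds infinitely often for every `j`, then there is a strictly increasing choice. -/
theorem exists_strictMono_of_frequently {P : ℕ → ℕ → Prop} (h : ∀ j N, ∃ n, N < n ∧ P j n) :
    ∃ φ : ℕ → ℕ, StrictMono φ ∧ ∀ j, P j (φ j) := by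
  choose f hf hP using h
  let φ : ℕ → ℕ := fun j => Nat.rec (f 0 0) (fun j n => f (j + 1) n) j
  refine ⟨φ, strictMono_nat_of_lt_succ fun j => hf _ _, fun j => ?_⟩
  cases j with
  | zero => exact hP _ _
  | succ j => exact hP _ _

theorem IsSymmetricBasis.exists_norm_le [CompleteSpace X] {b : SchauderBasis ℂ X}
    (hb : IsSymmetricBasis b) : ∃ B, ∀ n, ‖b n‖ ≤ B := by
  by_contra! h
  have h1 : ∀ j N : ℕ, ∃ n, N < n ∧ ‖b j‖ ≤ (1 / 2 : ℝ) ^ j * ‖b n‖ := by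
    intro j N
    -- The sum in the threshold forces `N < n`; the other summand gives the geometric inequality.
    obtain ⟨n, hn⟩ := h (∑ i ∈ Finset.range (N + 1), ‖b i‖ + 2 ^ j * ‖b j‖)
    refine ⟨n, ?_, ?_⟩
    · by_contra! hle
      have h2 : ‖b n‖ ≤ ∑ i ∈ Finset.range (N + 1), ‖b i‖ :=
        Finset.single_le_sum (f := fun i => ‖b i‖) (fun i _ => norm_nonneg _) (by simp; omega)
      have : 0 ≤ 2 ^ j * ‖b j‖ := by positivity
      linarith
    · have h2 : 0 ≤ ∑ i ∈ Finset.range (N + 1), ‖b i‖ := Finset.sum_nonneg fun i _ => norm_nonneg _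
      rw [one_div, inv_pow, le_inv_mul_iff₀ (by positivity)]
      linarith
  obtain ⟨ψ, hψ, hle⟩ := exists_strictMono_of_frequently h1
  exact hb.not_norm_le_pow_mul (φ := id) Function.injective_id hψ.injective hle

theorem IsSymmetricBasis.exists_le_norm [CompleteSpace X] {b : SchauderBasis ℂ X}
    (hb : IsSymmetricBasis b) : ∃ δ > 0, ∀ n, δ ≤ ‖b n‖ := by
  by_contra! h
  have h1 : ∀ j N : ℕ, ∃ n, N < n ∧ ‖b n‖ ≤ (1 / 2 : ℝ) ^ j * ‖b j‖ := by
    intro j N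
    obtain ⟨i₀, hi₀, hmin⟩ := Finset.exists_min_image (Finset.range (N + 1)) (fun i => ‖b i‖)
      ⟨0, by simp⟩
    -- Lying below the minimum over the indices up to `N` forces `N < n`.
    obtain ⟨n, hn⟩ := h (min ‖b i₀‖ ((1 / 2 : ℝ) ^ j * ‖b j‖))
      (lt_min (b.norm_pos _) (mul_pos (by positivity) (b.norm_pos _)))
    refine ⟨n, ?_, (hn.trans_le (min_le_right _ _)).le⟩
    by_contra! hle
    exact absurd (hmin n (by simp; omega)) (not_le.2 (hn.trans_le (min_le_left _ _)))
  obtain ⟨φ, hφ, hle⟩ := exists_strictMono_of_frequently h1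
  exact hb.not_norm_le_pow_mul (ψ := id) hφ.injective Function.injective_id hle

end Symmetric

/-! ### Disjoint supports, the gliding hump, and equivalence with the unit vector basis. -/

section Lp

variable {p : ℝ≥0∞}

theorem lp.norm_rpow_sum_of_disjoint (hp : 0 < p.toReal) {u : ℕ → lp (fun _ : ℕ => ℂ) p}
    (hu : ∀ i j n, i ≠ j → u i n = 0 ∨ u j n = 0) (s : Finset ℕ) :
    ‖∑ j ∈ s, u j‖ ^ p.toReal = ∑ j ∈ s, ‖u j‖ ^ p.toReal := by
  classical
  have h : ∀ n, ‖(∑ j ∈ s, u j : lp (fun _ : ℕ => ℂ) p) n‖ ^ p.toReal =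
      ∑ j ∈ s, ‖u j n‖ ^ p.toReal := by
    intro n
    rw [lp.coeFn_sum, Finset.sum_apply]
    by_cases hn : ∃ i ∈ s, u i n ≠ 0
    · obtain ⟨i, hi, hin⟩ := hn
      have hz : ∀ j ∈ s, j ≠ i → u j n = 0 := fun j _ hji => (hu j i n hji).resolve_right hin
      rw [Finset.sum_eq_single_of_mem i hi hz, Finset.sum_eq_single_of_mem i hi]
      intro j hj hji
      simp [hz j hj hji, hp.ne']
    · push Not at hn
      rw [Finset.sum_eq_zero hn, Finset.sum_eq_zero fun j hj => by simp [hn j hj, hp.ne']]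
      simp [hp.ne']
  rw [lp.norm_rpow_eq_tsum hp, tsum_congr h,
    Summable.tsum_finsetSum fun j _ => (lp.memℓp (u j)).summable hp]
  exact Finset.sum_congr rfl fun j _ => (lp.norm_rpow_eq_tsum hp _).symm

/-- The Cauchy criteria of the two series coincide, with `ε` for the vectors corresponding to `ε ^
p` for the powers of the norms. -/
theorem lp.summable_iff_of_disjoint [Fact (1 ≤ p)] (hp : 0 < p.toReal)
    {u : ℕ → lp (fun _ : ℕ => ℂ) p} (hu : ∀ i j n, i ≠ j → u i n = 0 ∨ u j n = 0) :
    Summable u ↔ Summable fun j => ‖u j‖ ^ p.toReal := by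
  have hn : ∀ s : Finset ℕ, ‖∑ j ∈ s, ‖u j‖ ^ p.toReal‖ = ‖∑ j ∈ s, u j‖ ^ p.toReal := by
    intro s
    rw [lp.norm_rpow_sum_of_disjoint hp hu, Real.norm_of_nonneg]
    exact Finset.sum_nonneg fun j _ => by positivity
  rw [summable_iff_vanishing_norm, summable_iff_vanishing_norm]
  simp only [hn]
  constructor
  · intro h ε hε
    obtain ⟨s, hs⟩ := h (ε ^ p.toReal⁻¹) (by positivity)
    refine ⟨s, fun t ht => ?_⟩
    rw [← Real.rpow_inv_rpow hε.le hp.ne']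
    exact Real.rpow_lt_rpow (norm_nonneg _) (hs t ht) hp
  · intro h ε hε
    obtain ⟨s, hs⟩ := h (ε ^ p.toReal) (by positivity)
    exact ⟨s, fun t ht => (Real.rpow_lt_rpow_iff (norm_nonneg _) hε.le hp).1 (hs t ht)⟩

/-- The gliding hump: a coordinatewise null sequence in `ℓ_p` has a subsequence which is a small
perturbation of a disjointly supported sequence. -/
theorem lp.exists_glidingHump [Fact (1 ≤ p)] (hp_top : p ≠ ∞) {z : ℕ → lp (fun _ : ℕ => ℂ) p}
    (hz : ∀ m, Tendsto (fun n => z n m) atTop (𝓝 0)) {η : ℝ} (hη : 0 < η) :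
    ∃ φ : ℕ → ℕ, StrictMono φ ∧ ∃ u : ℕ → lp (fun _ : ℕ => ℂ) p,
      (∀ i j n, i ≠ j → u i n = 0 ∨ u j n = 0) ∧ ∀ j, ‖z (φ j) - u j‖ ≤ η * (1 / 2) ^ j := by
  have hp0 : 0 < p := lt_of_lt_of_le one_pos Fact.out
  have hstep : ∀ n N j : ℕ, ∃ n' N', n < n' ∧ N < N' ∧
      ‖z n' - ∑ i ∈ Finset.Ico N N', lp.single p i (z n' i)‖ ≤ η * (1 / 2) ^ j := by
    intro n N j
    -- Half of the error is for the head, small for late `n'` because `z` is coordinatewise null,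
    -- and half for the tail, small for large `N'`.
    have hε : 0 < η * (1 / 2) ^ j / 2 := by positivity
    have h1 : Tendsto (fun n' => ∑ i ∈ Finset.range N, ‖z n' i‖) atTop (𝓝 0) := by
      rw [← Finset.sum_const_zero (s := Finset.range N)]
      exact tendsto_finsetSum _ fun i _ => by simpa using (hz i).norm
    obtain ⟨n', hn', hlt⟩ := ((eventually_gt_atTop n).and (h1.eventually_lt_const hε)).exists
    have h2 := (lp.hasSum_single hp_top (z n')).tendsto_sum_nat
    have h3 := (tendsto_iff_norm_sub_tendsto_zero.1 h2).eventually_lt_const hε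
    obtain ⟨N', hN', hlt'⟩ := ((eventually_gt_atTop N).and h3).exists
    refine ⟨n', N', hn', hN', ?_⟩
    have h4 : ‖∑ i ∈ Finset.range N, lp.single (E := fun _ : ℕ => ℂ) p i (z n' i)‖ ≤
        ∑ i ∈ Finset.range N, ‖z n' i‖ := by
      refine (norm_sum_le _ _).trans (Finset.sum_le_sum fun i _ => ?_)
      rw [lp.norm_single hp0]
    have h5 : z n' - ∑ i ∈ Finset.Ico N N', lp.single p i (z n' i) =
        ∑ i ∈ Finset.range N, lp.single p i (z n' i) -
          (∑ i ∈ Finset.range N', lp.single p i (z n' i) - z n') := by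
      rw [Finset.sum_Ico_eq_sub _ hN'.le]
      abel
    rw [h5]
    refine (norm_sub_le _ _).trans ?_
    linarith
  choose f g hf hg hle using hstep
  -- `q i` holds the last chosen index and the right end of the last block, so block `i` is `[(q
  -- i).2, (q (i + 1)).2)`.
  let q : ℕ → ℕ × ℕ := fun i => Nat.rec (0, 0) (fun i s => (f s.1 s.2 i, g s.1 s.2 i)) i
  have hN : StrictMono fun i => (q i).2 := strictMono_nat_of_lt_succ fun i => hg _ _ _
  refine ⟨fun i => (q (i + 1)).1, strictMono_nat_of_lt_succ fun i => hf _ _ _,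
    fun i => ∑ l ∈ Finset.Ico (q i).2 (q (i + 1)).2, lp.single p l (z (q (i + 1)).1 l), ?_,
    fun i => hle (q i).1 (q i).2 i⟩
  have hsupp : ∀ i n, ¬ ((q i).2 ≤ n ∧ n < (q (i + 1)).2) →
      (∑ l ∈ Finset.Ico (q i).2 (q (i + 1)).2, lp.single p l (z (q (i + 1)).1 l) :
        lp (fun _ : ℕ => ℂ) p) n = 0 := by
    intro i n hn
    rw [lp.coeFn_sum, Finset.sum_apply]
    refine Finset.sum_eq_zero fun l hl => lp.single_apply_ne _ _ _ fun h => hn ?_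
    rw [h]
    exact Finset.mem_Ico.1 hl
  have hlt : ∀ i j n, i < j → ¬ ((q i).2 ≤ n ∧ n < (q (i + 1)).2) ∨
      ¬ ((q j).2 ≤ n ∧ n < (q (j + 1)).2) := by
    intro i j n hij
    have : (q (i + 1)).2 ≤ (q j).2 := hN.monotone hij
    omega
  intro i j n hij
  rcases hij.lt_or_gt with h | h
  · exact (hlt i j n h).imp (hsupp i n) (hsupp j n)
  · exact ((hlt j i n h).imp (hsupp j n) (hsupp i n)).symm

theorem summable_smul_of_norm_le_geometric {X : Type*} [NormedAddCommGroup X] [NormedSpace ℂ X]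
    [CompleteSpace X] {a : ℕ → ℂ} {A : ℝ} (ha : ∀ j, ‖a j‖ ≤ A) {v : ℕ → X} {η : ℝ}
    (hv : ∀ j, ‖v j‖ ≤ η * (1 / 2) ^ j) : Summable fun j => a j • v j := by
  apply Summable.of_norm_bounded (g := fun j => A * (η * (1 / 2 : ℝ) ^ j))
    ((summable_geometric_two.mul_left η).mul_left A)
  intro j
  rw [norm_smul]
  exact mul_le_mul (ha j) (hv j) (norm_nonneg _) ((norm_nonneg _).trans (ha 0))

theorem Memℓp.exists_norm_le {a : ℕ → ℂ} (ha : Memℓp a p) : ∃ A, ∀ j, ‖a j‖ ≤ A := by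
  obtain ⟨A, hA⟩ := memℓp_infty_iff.1 (ha.of_exponent_ge le_top)
  exact ⟨A, fun j => hA ⟨j, rfl⟩⟩

/-- The disjoint part converges because `∑ ‖aⱼ uⱼ‖ ^ p` does; the perturbation converges absolutely
because `a` is bounded. A lower bound on the norms gives the converse in
`lp.memℓp_of_summable_smul`. -/
theorem lp.summable_smul_of_perturbation [Fact (1 ≤ p)] (hp : 0 < p.toReal)
    {z u : ℕ → lp (fun _ : ℕ => ℂ) p} (hu : ∀ i j n, i ≠ j → u i n = 0 ∨ u j n = 0)
    {η : ℝ} (hzu : ∀ j, ‖z j - u j‖ ≤ η * (1 / 2) ^ j) {B : ℝ} (hB : ∀ j, ‖u j‖ ≤ B)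
    {a : ℕ → ℂ} (ha : Memℓp a p) : Summable fun j => a j • z j := by
  obtain ⟨A, hA⟩ := ha.exists_norm_le
  have h1 : Summable fun j => a j • u j := by
    rw [lp.summable_iff_of_disjoint hp]
    · have hs := (ha.summable hp).mul_right (B ^ p.toReal)
      refine Summable.of_nonneg_of_le (fun j => by positivity) (fun j => ?_) hs
      rw [norm_smul, Real.mul_rpow (norm_nonneg _) (norm_nonneg _)]
      gcongr
      exact hB j
    · intro i j n hij
      simp only [lp.coeFn_smul, Pi.smul_apply, smul_eq_mul]
      exact (hu i j n hij).imp (fun h => by rw [h, mul_zero]) fun h => by rw [h, mul_zero]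
  convert h1.add (summable_smul_of_norm_le_geometric hA hzu) using 2 with j
  rw [← smul_add]
  congr 1
  abel

theorem lp.memℓp_of_summable_smul [Fact (1 ≤ p)] (hp : 0 < p.toReal)
    {z u : ℕ → lp (fun _ : ℕ => ℂ) p} (hu : ∀ i j n, i ≠ j → u i n = 0 ∨ u j n = 0)
    {η : ℝ} (hzu : ∀ j, ‖z j - u j‖ ≤ η * (1 / 2) ^ j) {δ : ℝ} (hδ : 0 < δ)
    (hz : ∀ j, δ ≤ ‖z j‖) (hδu : ∀ j, δ ≤ ‖u j‖)
    {a : ℕ → ℂ} (ha : Summable fun j => a j • z j) : Memℓp a p := by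
  obtain ⟨A, hA⟩ : ∃ A, ∀ j, ‖a j‖ ≤ A := by
    obtain ⟨A, hA⟩ := ha.tendsto_atTop_zero.norm.bddAbove_range
    refine ⟨A / δ, fun j => ?_⟩
    have h1 : ‖a j • z j‖ ≤ A := hA ⟨j, rfl⟩
    rw [norm_smul] at h1
    rw [le_div_iff₀ hδ]
    exact (mul_le_mul_of_nonneg_left (hz j) (norm_nonneg _)).trans h1
  have h1 : Summable fun j => a j • u j := by
    convert ha.sub (summable_smul_of_norm_le_geometric hA hzu) using 2 with j
    rw [← smul_sub]
    congr 1
    abel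
  rw [lp.summable_iff_of_disjoint hp] at h1
  · apply memℓp_gen
    refine Summable.of_nonneg_of_le (fun j => by positivity) (fun j => ?_)
      (h1.mul_right ((δ ^ p.toReal)⁻¹))
    rw [norm_smul, Real.mul_rpow (norm_nonneg _) (norm_nonneg _), ← div_eq_mul_inv,
      le_div_iff₀ (by positivity)]
    gcongr
    exact hδu j
  · intro i j n hij
    simp only [lp.coeFn_smul, Pi.smul_apply, smul_eq_mul]
    exact (hu i j n hij).imp (fun h => by rw [h, mul_zero]) fun h => by rw [h, mul_zero]

/-- Tychonoff's theorem on a product of discs gives the coordinatewise limit, and the uniform norm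
bound keeps the limit in `ℓ_p`. -/
theorem lp.exists_subseq_tendsto_coord [Fact (1 ≤ p)] {z : ℕ → lp (fun _ : ℕ => ℂ) p} {B : ℝ}
    (hB : ∀ n, ‖z n‖ ≤ B) : ∃ φ : ℕ → ℕ, StrictMono φ ∧ ∃ y : lp (fun _ : ℕ => ℂ) p,
      ∀ m, Tendsto (fun j => z (φ j) m) atTop (𝓝 (y m)) := by
  have hp0 : p ≠ 0 := (lt_of_lt_of_le one_pos (Fact.out : 1 ≤ p)).ne'
  have hc : IsCompact (Set.univ.pi fun _ : ℕ => Metric.closedBall (0 : ℂ) B) :=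
    isCompact_univ_pi fun _ => isCompact_closedBall _ _
  obtain ⟨y, -, φ, hφ, hy⟩ := hc.tendsto_subseq (x := fun n m => z n m) fun n m _ =>
    mem_closedBall_zero_iff.2 ((lp.norm_apply_le_norm hp0 _ _).trans (hB n))
  have hmem : Memℓp y p := by
    refine lp.memℓp_of_tendsto (l := atTop) (F := fun j => z (φ j)) ?_ hy
    rw [isBounded_iff_forall_norm_le]
    exact ⟨B, by rintro _ ⟨j, rfl⟩; exact hB _⟩
  exact ⟨φ, hφ, ⟨y, hmem⟩, fun m => tendsto_pi_nhds.1 hy m⟩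

theorem memℓp_inv_succ (hp_one : 1 < p) (hp_top : p ≠ ∞) :
    Memℓp (fun j : ℕ => (((j : ℝ) + 1)⁻¹ : ℂ)) p := by
  have h1 : 1 < p.toReal := by
    simpa using (ENNReal.toReal_lt_toReal ENNReal.one_ne_top hp_top).2 hp_one
  apply memℓp_gen
  have h2 := (summable_nat_add_iff 1).2 (Real.summable_nat_rpow_inv.2 h1)
  refine h2.congr fun j => ?_
  have h3 : ‖(((j : ℝ) + 1)⁻¹ : ℂ)‖ = ((j : ℝ) + 1)⁻¹ := by
    rw [norm_inv, ← Complex.ofReal_one, ← Complex.ofReal_add, Complex.norm_real,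
      Real.norm_of_nonneg (by positivity)]
  rw [h3, Real.inv_rpow (by positivity)]
  push_cast
  rfl

/-- If the harmonically weighted series of the vectors `b_{φ(j)} - y`, where `b` is a Schauder basis
and `φ` is injective, converges, then `y = 0`. -/
theorem SchauderBasis.eq_zero_of_summable_harmonic {X : Type*} [NormedAddCommGroup X]
    [NormedSpace ℂ X] (b : SchauderBasis ℂ X) {φ : ℕ → ℕ} (hφ : φ.Injective) {y : X}
    (h : Summable fun j : ℕ => (((j : ℝ) + 1)⁻¹ : ℂ) • (b (φ j) - y)) : y = 0 := by
  obtain ⟨x, hx⟩ := h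
  have hx1 := hx.tendsto_sum_nat
  have hH : Tendsto (fun N : ℕ => ∑ j ∈ Finset.range N, ((j : ℝ) + 1)⁻¹) atTop atTop := by
    simpa using Real.tendsto_sum_range_one_div_nat_succ_atTop
  have hcoord : ∀ m, b.coord m y = 0 := by
    intro m
    have h1 := ((b.coord m).continuous.tendsto x).comp hx1
    have h2 : ∀ N : ℕ, (b.coord m) (∑ j ∈ Finset.range N, (((j : ℝ) + 1)⁻¹ : ℂ) • (b (φ j) - y)) =
        ∑ j ∈ Finset.range N, (((j : ℝ) + 1)⁻¹ : ℂ) * b.coord m (b (φ j)) -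
          ((∑ j ∈ Finset.range N, ((j : ℝ) + 1)⁻¹ : ℝ) : ℂ) * b.coord m y := by
      intro N
      rw [map_sum]
      simp only [map_smul, map_sub, smul_eq_mul, mul_sub, Finset.sum_sub_distrib]
      rw [← Finset.sum_mul]
      push_cast
      rfl
    have h3 : ∃ c, Tendsto (fun N : ℕ =>
        ∑ j ∈ Finset.range N, (((j : ℝ) + 1)⁻¹ : ℂ) * b.coord m (b (φ j))) atTop (𝓝 c) := by
      have hs : Summable fun j : ℕ => (((j : ℝ) + 1)⁻¹ : ℂ) * b.coord m (b (φ j)) := by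
        apply summable_of_hasFiniteSupport
        refine (Set.Finite.preimage hφ.injOn (Set.finite_singleton m)).subset fun j hj => ?_
        by_contra hne
        have hne' : m ≠ φ j := fun h => hne h.symm
        simp [b.ortho, hne'] at hj
      exact ⟨_, hs.hasSum.tendsto_sum_nat⟩
    obtain ⟨c, hc⟩ := h3
    have h4 : Tendsto (fun N : ℕ => ((∑ j ∈ Finset.range N, ((j : ℝ) + 1)⁻¹ : ℝ) : ℂ) * b.coord m y)
        atTop (𝓝 (c - b.coord m x)) := by
      refine (hc.sub h1).congr fun N => ?_
      simp only [Function.comp, h2]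
      ring
    by_contra hne
    have h5 : Tendsto (fun N : ℕ => (∑ j ∈ Finset.range N, ((j : ℝ) + 1)⁻¹) * ‖b.coord m y‖)
        atTop atTop := hH.atTop_mul_const (norm_pos_iff.2 hne)
    refine not_tendsto_nhds_of_tendsto_atTop h5 ‖c - b.coord m x‖ (h4.norm.congr fun N => ?_)
    rw [norm_mul, Complex.norm_real, Real.norm_of_nonneg]
    exact Finset.sum_nonneg fun j _ => by positivity
  have h6 := b.expansion y
  simp only [hcoord, zero_smul] at h6
  exact h6.unique hasSum_zero

theorem IsSymmetricBasis.exists_subseq_summable_iff_memℓp [Fact (1 ≤ p)] (hp_one : 1 < p)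
    (hp_top : p ≠ ∞) {e : SchauderBasis ℂ (lp (fun _ : ℕ => ℂ) p)} (he : IsSymmetricBasis e) :
    ∃ φ : ℕ → ℕ, φ.Injective ∧ (Set.range φ)ᶜ.Infinite ∧
      ∀ c : ℕ → ℂ, Summable (fun j => c j • e (φ j)) ↔ Memℓp c p := by
  have hp : 0 < p.toReal := ENNReal.toReal_pos (zero_lt_one.trans hp_one).ne' hp_top
  obtain ⟨B, hB⟩ := he.exists_norm_le
  obtain ⟨δ, hδ, hle⟩ := he.exists_le_norm
  obtain ⟨φ₁, hφ₁, y, hy⟩ := lp.exists_subseq_tendsto_coord hB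
  -- The tolerance `δ / 2` is half the lower bound of the basis norms, so that `‖u j‖ ≥ δ / 2` once
  -- `y = 0` is known.
  obtain ⟨φ₂, hφ₂, u, hu, hzu⟩ := lp.exists_glidingHump hp_top (z := fun j => e (φ₁ j) - y)
    (fun m => by simpa using (hy m).sub_const (y m)) (half_pos hδ)
  have hb : ∀ j, ‖e (φ₁ (φ₂ j)) - y - u j‖ ≤ δ / 2 := fun j => (hzu j).trans
    (mul_le_of_le_one_right (half_pos hδ).le (pow_le_one₀ (by norm_num) (by norm_num)))
  have hinj : Function.Injective fun j => φ₁ (φ₂ j) := (hφ₁.comp hφ₂).injective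
  have hub : ∀ j, ‖u j‖ ≤ B + ‖y‖ + δ / 2 := by
    intro j
    have h1 := norm_sub_norm_le (u j) (e (φ₁ (φ₂ j)) - y)
    rw [norm_sub_rev (u j)] at h1
    have h2 := norm_sub_le (e (φ₁ (φ₂ j))) y
    linarith [hb j, hB (φ₁ (φ₂ j))]
  obtain rfl : y = 0 := e.eq_zero_of_summable_harmonic hinj
    (lp.summable_smul_of_perturbation hp hu hzu hub (memℓp_inv_succ hp_one hp_top))
  simp only [sub_zero] at hzu hb
  have hlow : ∀ j, δ / 2 ≤ ‖u j‖ := by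
    intro j
    have h1 := norm_sub_norm_le (e (φ₁ (φ₂ j))) (u j)
    linarith [hb j, hle (φ₁ (φ₂ j))]
  have htwo : Function.Injective fun j : ℕ => 2 * j := fun i j h => by simpa using h
  have hzu' : ∀ j, ‖e (φ₁ (φ₂ (2 * j))) - u (2 * j)‖ ≤ δ / 2 * (1 / 2) ^ j := fun j =>
    (hzu (2 * j)).trans (mul_le_mul_of_nonneg_left
      (pow_le_pow_of_le_one (by norm_num) (by norm_num) (by omega)) (half_pos hδ).le)
  have hu' : ∀ i j n, i ≠ j → u (2 * i) n = 0 ∨ u (2 * j) n = 0 := fun i j n hij =>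
    hu _ _ n (htwo.ne hij)
  exact ⟨fun j => φ₁ (φ₂ (2 * j)), hinj.comp htwo, infinite_compl_range_comp_two_mul hinj, fun c =>
    ⟨lp.memℓp_of_summable_smul hp hu' hzu' (half_pos hδ)
      (fun j => by linarith [hle (φ₁ (φ₂ (2 * j)))]) fun j => hlow _,
      lp.summable_smul_of_perturbation hp hu' hzu' fun j => hub _⟩⟩

/-- Each symmetric basis of `ℓ_p`, `1 < p < ∞`, is equivalent to the unit vector basis. -/
theorem IsSymmetricBasis.summable_iff_memℓp [Fact (1 ≤ p)] (hp_one : 1 < p) (hp_top : p ≠ ∞)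
    {e : SchauderBasis ℂ (lp (fun _ : ℕ => ℂ) p)} (he : IsSymmetricBasis e) {a : ℕ → ℂ} :
    Summable (fun n => a n • e n) ↔ Memℓp a p := by
  have hp : 0 < p.toReal := ENNReal.toReal_pos (zero_lt_one.trans hp_one).ne' hp_top
  obtain ⟨φ, hφ, hφc, hsub⟩ := he.exists_subseq_summable_iff_memℓp hp_one hp_top
  have htwo : Function.Injective fun j : ℕ => 2 * j := fun i j h => by simpa using h
  have htwo' : Function.Injective fun j : ℕ => 2 * j + 1 := fun i j h => by simpa using h
  have hspread : ∀ ψ : ℕ → ℕ, ψ.Injective → (Set.range ψ)ᶜ.Infinite → ∀ c : ℕ → ℂ,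
      (Summable (fun j => c j • e (ψ j)) ↔ Memℓp c p) := fun ψ hψ hψc c =>
    ⟨fun h => (hsub c).1 (he.summable_transport hψ hφ hψc hφc h),
      fun h => he.summable_transport hφ hψ hφc hψc ((hsub c).2 h)⟩
  -- The whole basis has no infinite complement to spare; its even and odd halves do.
  have heven := hspread _ htwo (infinite_compl_range_comp_two_mul Function.injective_id)
  have hodd := hspread _ htwo' (infinite_compl_range_comp_two_mul (add_left_injective 1))
  constructor
  · intro h
    have h1 := ((heven fun j => a (2 * j)).1 (h.comp_injective htwo)).summable hp
    have h2 := ((hodd fun j => a (2 * j + 1)).1 (h.comp_injective htwo')).summable hp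
    exact memℓp_gen (Summable.even_add_odd (f := fun n => ‖a n‖ ^ p.toReal) h1 h2)
  · intro h
    have hs := h.summable hp
    have h1 := (heven fun j => a (2 * j)).2 (memℓp_gen (hs.comp_injective htwo))
    have h2 := (hodd fun j => a (2 * j + 1)).2 (memℓp_gen (hs.comp_injective htwo'))
    exact Summable.even_add_odd (f := fun n => a n • e n) h1 h2

end Lp

/-! ### Hardy's inequality. -/

section Hardy

/-- The one-step inequality behind Hardy's inequality (Elliott), for the passage from a mean `A` of
`n` terms to the mean `A' = (n A + a) / (n + 1)`. -/
theorem hardy_step {r q A a : ℝ} (hrq : r.HolderConjugate q) (hA : 0 ≤ A) (ha : 0 ≤ a) (n : ℕ) :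
    ((n + 1 : ℝ)) * ((n * A + a) / (n + 1)) ^ r +
        (r - 1) / r * ((n * A + a) / (n + 1)) ^ r ≤
      (r - 1) / r * (q * a) ^ r + n * A ^ r := by
  have hn : (0 : ℝ) < n + 1 := by positivity
  have hr := hrq.pos
  have hq0 := hrq.symm.pos
  set A' := (n * A + a) / (n + 1) with hA'
  have hA'0 : 0 ≤ A' := by positivity
  have hS : (n + 1) * A' = n * A + a := by rw [hA']; field_simp
  have hmul : A' * A' ^ (r - 1) = A' ^ r := by
    have h := Real.rpow_add_one' hA'0 (y := r - 1) (by simpa using hr.ne')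
    rw [sub_add_cancel] at h
    rw [h, mul_comm]
  have hpow : (A' ^ (r - 1)) ^ q = A' ^ r := by
    rw [← Real.rpow_mul hA'0, hrq.sub_one_mul_conj]
  have hr1 : r / q = r - 1 := hrq.div_conj_eq_sub_one
  have hinv : 1 / r + 1 / q = 1 := by simpa using hrq.inv_add_inv_eq_one
  -- Young's inequality is applied to `A · A' ^ (r-1)` and to `qa · A' ^ (r-1)`; the weight `q`
  -- produces Hardy's constant. The identity `a = (n+1)A' - nA` links the two.
  have hy := Real.young_inequality_of_nonneg hA (Real.rpow_nonneg hA'0 (r - 1)) hrq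
  have hz := Real.young_inequality_of_nonneg (mul_nonneg hq0.le ha)
    (Real.rpow_nonneg hA'0 (r - 1)) hrq
  rw [hpow] at hy hz
  have hy2 : r * (A * A' ^ (r - 1)) ≤ A ^ r + (r - 1) * A' ^ r := by
    have h1 := mul_le_mul_of_nonneg_left hy hr.le
    have h2 : r * (A ^ r / r + A' ^ r / q) = A ^ r + (r - 1) * A' ^ r := by
      rw [← hr1]
      field_simp
    rwa [h2] at h1
  have hz2 : r * (a * A' ^ (r - 1)) ≤ (r - 1) / r * (q * a) ^ r + (r - 1) * A' ^ r -
      (r - 1) / r * A' ^ r := by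
    have h1 := mul_le_mul_of_nonneg_left hz hrq.sub_one_pos.le
    have h2 : (r - 1) * (q * a * A' ^ (r - 1)) = r * (a * A' ^ (r - 1)) := by
      rw [← hr1]
      field_simp
    have h3 : (r - 1) * ((q * a) ^ r / r + A' ^ r / q) =
        (r - 1) / r * (q * a) ^ r + (r - 1) * A' ^ r - (r - 1) / r * A' ^ r := by
      rw [div_eq_mul_one_div (A' ^ r), show 1 / q = 1 - 1 / r by linarith]
      ring
    rwa [h2, h3] at h1
  have h4 : a * A' ^ (r - 1) = (n + 1) * A' ^ r - n * (A * A' ^ (r - 1)) := by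
    rw [← hmul]
    linear_combination A' ^ (r - 1) * (-hS)
  have h5 := mul_le_mul_of_nonneg_left hy2 (Nat.cast_nonneg (α := ℝ) n)
  have h6 : r * (a * A' ^ (r - 1)) = r * ((n + 1) * A' ^ r) - n * (r * (A * A' ^ (r - 1))) := by
    rw [h4]
    ring
  linarith

/-- **Hardy's inequality** for finite sums. -/
theorem sum_mean_rpow_le {r q : ℝ} (hrq : r.HolderConjugate q) {a : ℕ → ℝ} (ha : ∀ n, 0 ≤ a n)
    (N : ℕ) :
    ∑ n ∈ Finset.range N, ((∑ i ∈ Finset.range (n + 1), a i) / (n + 1)) ^ r ≤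
      ∑ n ∈ Finset.range N, (q * a n) ^ r := by
  have hr := hrq.pos
  have hpos : 0 < (r - 1) / r := div_pos hrq.sub_one_pos hr
  -- The additional term `N · mean ^ r` makes the induction close through `hardy_step`; being
  -- nonnegative, it is dropped at the end.
  have key : (r - 1) / r * ∑ n ∈ Finset.range N, ((∑ i ∈ Finset.range (n + 1), a i) / (n + 1)) ^ r +
      N * ((∑ i ∈ Finset.range N, a i) / N) ^ r ≤
      (r - 1) / r * ∑ n ∈ Finset.range N, (q * a n) ^ r := by
    induction N with
    | zero => simp
    | succ N ih =>
      have hS : 0 ≤ ∑ i ∈ Finset.range N, a i := Finset.sum_nonneg fun i _ => ha i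
      have h1 := hardy_step hrq (A := (∑ i ∈ Finset.range N, a i) / N) (by positivity) (ha N) N
      have h2 : (N : ℝ) * ((∑ i ∈ Finset.range N, a i) / N) + a N =
          ∑ i ∈ Finset.range (N + 1), a i := by
        rw [Finset.sum_range_succ]
        rcases Nat.eq_zero_or_pos N with rfl | hN
        · simp
        · rw [mul_div_cancel₀]
          positivity
      rw [h2] at h1
      rw [Finset.sum_range_succ (fun n => ((∑ i ∈ Finset.range (n + 1), a i) / (n + 1 : ℝ)) ^ r),
        Finset.sum_range_succ (fun n => (q * a n) ^ r)]
      push_cast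
      linarith
  have h0 : 0 ≤ (N : ℝ) * ((∑ i ∈ Finset.range N, a i) / N) ^ r := by
    have hS : 0 ≤ ∑ i ∈ Finset.range N, a i := Finset.sum_nonneg fun i _ => ha i
    positivity
  exact le_of_mul_le_mul_left (by linarith) hpos

variable {p : ℝ≥0∞}

theorem lp.exists_mean (hp_one : 1 < p) (hp_top : p ≠ ∞) :
    ∃ C, 0 ≤ C ∧ ∀ a : lp (fun _ : ℕ => ℝ) p, (∀ n, 0 ≤ a n) →
      ∃ h : lp (fun _ : ℕ => ℝ) p, ‖h‖ ≤ C * ‖a‖ ∧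
        ∀ n, h n = (∑ i ∈ Finset.range (n + 1), a i) / (n + 1) := by
  have h1 : 1 < p.toReal := by
    simpa using (ENNReal.toReal_lt_toReal ENNReal.one_ne_top hp_top).2 hp_one
  have hp : 0 < p.toReal := one_pos.trans h1
  have hrq := Real.HolderConjugate.conjExponent h1
  set q := p.toReal.conjExponent
  have hq : 0 ≤ q := hrq.symm.nonneg
  refine ⟨q, hq, fun a ha => ?_⟩
  let g : ℕ → ℝ := fun n => (∑ i ∈ Finset.range (n + 1), a i) / (n + 1)
  have hg0 : ∀ n, 0 ≤ g n := fun n => div_nonneg (Finset.sum_nonneg fun i _ => ha i) (by positivity)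
  have hg : ∀ s : Finset ℕ, ∑ n ∈ s, ‖g n‖ ^ p.toReal ≤ (q * ‖a‖) ^ p.toReal := by
    intro s
    obtain ⟨N, hN⟩ := s.exists_nat_subset_range
    calc ∑ n ∈ s, ‖g n‖ ^ p.toReal ≤ ∑ n ∈ Finset.range N, ‖g n‖ ^ p.toReal :=
          Finset.sum_le_sum_of_subset_of_nonneg hN fun n _ _ => by positivity
      _ = ∑ n ∈ Finset.range N, g n ^ p.toReal :=
          Finset.sum_congr rfl fun n _ => by rw [Real.norm_of_nonneg (hg0 n)]
      _ ≤ ∑ n ∈ Finset.range N, (q * a n) ^ p.toReal := sum_mean_rpow_le hrq ha N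
      _ = q ^ p.toReal * ∑ n ∈ Finset.range N, ‖a n‖ ^ p.toReal := by
          rw [Finset.mul_sum]
          exact Finset.sum_congr rfl fun n _ => by
            rw [Real.mul_rpow hq (ha n), Real.norm_of_nonneg (ha n)]
      _ ≤ q ^ p.toReal * ‖a‖ ^ p.toReal :=
          mul_le_mul_of_nonneg_left (lp.sum_rpow_le_norm_rpow hp a _) (by positivity)
      _ = (q * ‖a‖) ^ p.toReal := (Real.mul_rpow hq (lp.norm_nonneg' a)).symm
  exact ⟨⟨g, memℓp_gen' hg⟩,
    lp.norm_le_of_forall_sum_le hp (mul_nonneg hq (lp.norm_nonneg' a)) hg, fun n => rfl⟩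

end Hardy

/-! ### Differences, iterated sums and the multiplier estimate. -/

section Difference

/-- The sequence of partial sums, the inverse of the backward difference. -/
def partialSums (a : ℕ → ℝ) (n : ℕ) : ℝ := ∑ i ∈ Finset.range (n + 1), a i

theorem backwardDiff_zero (c : ℕ → ℂ) : backwardDiff c 0 = c 0 := by simp [backwardDiff]

theorem backwardDiff_succ (c : ℕ → ℂ) (n : ℕ) : backwardDiff c (n + 1) = c (n + 1) - c n := by
  simp [backwardDiff]

theorem eq_sum_backwardDiff (c : ℕ → ℂ) (n : ℕ) :
    c n = ∑ i ∈ Finset.range (n + 1), backwardDiff c i := by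
  induction n with
  | zero => simp [backwardDiff_zero]
  | succ n ih => rw [Finset.sum_range_succ, ← ih, backwardDiff_succ]; ring

theorem backwardDiff_surjective : Function.Surjective backwardDiff := by
  intro d
  refine ⟨fun n => ∑ i ∈ Finset.range (n + 1), d i, funext fun n => ?_⟩
  cases n with
  | zero => simp [backwardDiff_zero]
  | succ n => rw [backwardDiff_succ, Finset.sum_range_succ _ (n + 1)]; ring

theorem backwardDiff_pow_surjective (k : ℕ) : Function.Surjective (backwardDiff ^ k) := by
  rw [Module.End.coe_pow]
  exact backwardDiff_surjective.iterate k

theorem partialSums_iterate_nonneg {a : ℕ → ℝ} (ha : ∀ n, 0 ≤ a n) (k n : ℕ) :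
    0 ≤ partialSums^[k] a n := by
  induction k generalizing n with
  | zero => exact ha n
  | succ k ih =>
    rw [Function.iterate_succ_apply']
    exact Finset.sum_nonneg fun i _ => ih i

theorem partialSums_iterate_monotone {a : ℕ → ℝ} (ha : ∀ n, 0 ≤ a n) {k : ℕ} (hk : 1 ≤ k) :
    Monotone (partialSums^[k] a) := by
  obtain ⟨k, rfl⟩ := Nat.exists_eq_add_of_le' hk
  rw [Function.iterate_succ_apply']
  exact monotone_nat_of_le_succ fun n => by
    rw [partialSums, partialSums, Finset.sum_range_succ _ (n + 1)]
    exact le_add_of_nonneg_right (partialSums_iterate_nonneg ha k _)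

theorem norm_le_partialSums_iterate (k : ℕ) (c : ℕ → ℂ) (n : ℕ) :
    ‖c n‖ ≤ partialSums^[k] (fun m => ‖(backwardDiff ^ k) c m‖) n := by
  induction k generalizing c n with
  | zero => simp
  | succ k ih =>
    rw [Function.iterate_succ_apply', eq_sum_backwardDiff c n]
    refine (norm_sum_le _ _).trans (Finset.sum_le_sum fun i _ => ?_)
    simpa [pow_succ] using ih (backwardDiff c) i

/-- `Δᵏ` at `n` only looks at a window of `k + 1` entries, with binomial weights of total modulus at
most `2 ^ k`. -/
theorem norm_backwardDiff_pow_le (k : ℕ) {w : ℕ → ℂ} {n : ℕ} {R : ℝ}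
    (hw : ∀ i, i ≤ k → i ≤ n → ‖w (n - i)‖ ≤ R) : ‖(backwardDiff ^ k) w n‖ ≤ 2 ^ k * R := by
  induction k generalizing n with
  | zero => simpa using hw 0 le_rfl (Nat.zero_le n)
  | succ k ih =>
    have hR : 0 ≤ R := (norm_nonneg _).trans (hw 0 (Nat.zero_le _) (Nat.zero_le n))
    have h1 := ih (n := n) fun i hi hin => hw i (by omega) hin
    rw [pow_succ', Module.End.mul_apply]
    cases n with
    | zero =>
      rw [backwardDiff_zero]
      refine h1.trans ?_
      rw [pow_succ]
      have : 0 ≤ 2 ^ k * R := by positivity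
      linarith
    | succ n =>
      have h2 := ih (n := n) fun i hi hin => by
        have := hw (i + 1) (by omega) (by omega)
        rwa [Nat.add_sub_add_right] at this
      rw [backwardDiff_succ]
      refine (norm_sub_le _ _).trans ?_
      rw [pow_succ]
      linarith

/-- This replaces a Leibniz formula: `m` is frozen at its value `m n`, and only the variation of `m`
over the window meets the size of `c`. -/
theorem norm_backwardDiff_pow_mul_le (k : ℕ) {m c : ℕ → ℂ} {n : ℕ} {ε D : ℝ} (hε : 0 ≤ ε)
    (hm : ∀ i, 1 ≤ i → i ≤ k → i ≤ n → ‖m (n - i) - m n‖ ≤ ε)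
    (hc : ∀ i, i ≤ n → ‖c (n - i)‖ ≤ D) :
    ‖(backwardDiff ^ k) (m * c) n‖ ≤ ‖m n‖ * ‖(backwardDiff ^ k) c n‖ + 2 ^ k * (ε * D) := by
  have h1 : (backwardDiff ^ k) (m * c) n = m n * (backwardDiff ^ k) c n +
      (backwardDiff ^ k) (fun j => (m j - m n) * c j) n := by
    have : m * c = m n • c + fun j => (m j - m n) * c j := by
      funext j
      simp only [Pi.mul_apply, Pi.add_apply, Pi.smul_apply, smul_eq_mul]
      ring
    rw [this, map_add, map_smul]
    rfl
  rw [h1]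
  refine (norm_add_le _ _).trans (add_le_add (norm_mul_le _ _) (norm_backwardDiff_pow_le k ?_))
  intro i hi hin
  rw [norm_mul]
  rcases Nat.eq_zero_or_pos i with rfl | hi0
  · have : 0 ≤ D := (norm_nonneg _).trans (hc 0 hin)
    simp only [Nat.sub_zero, sub_self, norm_zero, zero_mul]
    positivity
  · exact mul_le_mul (hm i hi0 hi hin) (hc i hin) (norm_nonneg _) hε

variable {p : ℝ≥0∞}

/-- A partial sum is `n + 1` times a mean. Each summation thus costs one factor `n + 1` and one use
of Hardy's inequality. -/
theorem lp.exists_partialSums_iterate_le (hp_one : 1 < p) (hp_top : p ≠ ∞) (k : ℕ) :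
    ∃ C, 0 ≤ C ∧ ∀ a : lp (fun _ : ℕ => ℝ) p, (∀ n, 0 ≤ a n) →
      ∃ h : lp (fun _ : ℕ => ℝ) p, ‖h‖ ≤ C * ‖a‖ ∧ (∀ n, 0 ≤ h n) ∧
        ∀ n : ℕ, partialSums^[k] a n ≤ (n + 1) ^ k * h n := by
  obtain ⟨C₁, hC₁, H⟩ := lp.exists_mean hp_one hp_top
  induction k with
  | zero => exact ⟨1, zero_le_one, fun a ha => ⟨a, by simp, ha, fun n => by simp⟩⟩
  | succ k ih =>
    obtain ⟨C, hC, hk⟩ := ih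
    refine ⟨C₁ * C, mul_nonneg hC₁ hC, fun a ha => ?_⟩
    obtain ⟨h, hle, h0, hb⟩ := hk a ha
    obtain ⟨g, hgle, hg⟩ := H h h0
    refine ⟨g, ?_, fun n => ?_, fun n => ?_⟩
    · rw [mul_assoc]
      exact hgle.trans (mul_le_mul_of_nonneg_left hle hC₁)
    · rw [hg]
      exact div_nonneg (Finset.sum_nonneg fun i _ => h0 i) (by positivity)
    · rw [Function.iterate_succ_apply', hg, pow_succ, mul_assoc, mul_div_cancel₀ _ (by positivity),
        Finset.mul_sum]
      refine Finset.sum_le_sum fun i hi => (hb i).trans ?_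
      have hin : (i : ℝ) ≤ n := by
        exact_mod_cast Nat.lt_succ_iff.1 (Finset.mem_range.1 hi)
      have := h0 i
      gcongr

/-- A multiplier `m` with `|mₙ₋ᵢ - mₙ| ≤ L n⁻ᵏ` acts on the sequences `c` with `Δᵏ c ∈ ℓ_p`, with a
bound which depends on `m` only through `sup |mₙ|` and `L`. -/
theorem lp.exists_multiplier_bound [Fact (1 ≤ p)] (hp_one : 1 < p) (hp_top : p ≠ ∞) {k : ℕ}
    (hk : 1 ≤ k) : ∃ C, 0 ≤ C ∧ ∀ (d : lp (fun _ : ℕ => ℂ) p) (c : ℕ → ℂ),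
      (∀ n, (backwardDiff ^ k) c n = d n) → ∃ h : lp (fun _ : ℕ => ℝ) p, ‖h‖ ≤ C * ‖d‖ ∧
        ∀ (m : ℕ → ℂ) (B L : ℝ), 0 ≤ L → (∀ n, ‖m n‖ ≤ B) →
          (∀ n i : ℕ, 1 ≤ i → i ≤ k → i ≤ n → ‖m (n - i) - m n‖ ≤ L * ((n + 1 : ℝ) ^ k)⁻¹) →
          ∀ n, ‖(backwardDiff ^ k) (m * c) n‖ ≤ B * ‖d n‖ + L * h n := by
  obtain ⟨C, hC, H⟩ := lp.exists_partialSums_iterate_le hp_one hp_top k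
  refine ⟨2 ^ k * C, by positivity, fun d c hc => ?_⟩
  obtain ⟨h, hle, h0, hb⟩ := H (lp.toNorm d) fun n => norm_nonneg _
  refine ⟨(2 ^ k : ℝ) • h, ?_, fun m B L hL hB hm n => ?_⟩
  · rw [norm_smul, Real.norm_of_nonneg (by positivity), mul_assoc]
    rw [lp.norm_toNorm] at hle
    exact mul_le_mul_of_nonneg_left hle (by positivity)
  · have hn : (0 : ℝ) < (n + 1 : ℝ) ^ k := by positivity
    have hd : (fun j => ‖(backwardDiff ^ k) c j‖) = lp.toNorm d := by
      funext j
      rw [hc]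
      rfl
    have h1 := norm_backwardDiff_pow_mul_le k (D := (n + 1 : ℝ) ^ k * h n) (c := c)
      (mul_nonneg hL (inv_nonneg.2 hn.le)) (hm n) (fun i hi => ?_)
    · rw [hc] at h1
      refine h1.trans (add_le_add (mul_le_mul_of_nonneg_right (hB n) (norm_nonneg _)) (le_of_eq ?_))
      rw [lp.coeFn_smul, Pi.smul_apply, smul_eq_mul]
      field_simp
    -- Monotonicity, available since `1 ≤ k`, replaces the index `n - i` by `n`, so that one `h n`
    -- serves all earlier entries.
    · refine (norm_le_partialSums_iterate k c (n - i)).trans ?_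
      rw [hd]
      exact (partialSums_iterate_monotone (fun j => norm_nonneg _) hk (Nat.sub_le n i)).trans (hb n)

theorem lp.tendsto_of_dominated [Fact (1 ≤ p)] (hp : 0 < p.toReal) {ι : Type*} {l : Filter ι}
    [l.NeBot] {F : ι → lp (fun _ : ℕ => ℂ) p} {y : lp (fun _ : ℕ => ℂ) p} {g : ℕ → ℝ}
    (hg : Memℓp g p) (hF : ∀ᶠ i in l, ∀ n, ‖F i n‖ ≤ g n)
    (hlim : ∀ n, Tendsto (fun i => F i n) l (𝓝 (y n))) : Tendsto F l (𝓝 y) := by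
  have hy : ∀ n, ‖y n‖ ≤ g n := fun n =>
    le_of_tendsto (hlim n).norm (hF.mono fun i hi => hi n)
  have h1 : Tendsto (fun i => ∑' n, ‖F i n - y n‖ ^ p.toReal) l (𝓝 (∑' _ : ℕ, 0)) := by
    refine tendsto_tsum_of_dominated_convergence
      (bound := fun n => (2 : ℝ) ^ p.toReal * ‖g n‖ ^ p.toReal)
      ((hg.summable hp).mul_left _) (fun n => ?_) (hF.mono fun i hi n => ?_)
    · have h := ((tendsto_iff_norm_sub_tendsto_zero.1 (hlim n))).rpow_const (p := p.toReal)
        (Or.inr hp.le)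
      rwa [Real.zero_rpow hp.ne'] at h
    · rw [Real.norm_of_nonneg (by positivity), ← Real.mul_rpow (by norm_num) (norm_nonneg _)]
      refine Real.rpow_le_rpow (norm_nonneg _) ((norm_sub_le _ _).trans ?_) hp.le
      have := le_abs_self (g n)
      rw [Real.norm_eq_abs]
      linarith [hi n, hy n]
  rw [tsum_zero] at h1
  have h2 := h1.rpow_const (p := p.toReal⁻¹) (Or.inr (inv_nonneg.2 hp.le))
  rw [Real.zero_rpow (inv_pos.2 hp).ne'] at h2
  rw [tendsto_iff_norm_sub_tendsto_zero]
  refine h2.congr fun i => ?_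
  rw [lp.norm_eq_tsum_rpow hp, one_div]
  rfl

end Difference

/-! ### Identification of the space of formal series with `ℓ_p`. -/

section Coefficients

variable {p : ℝ≥0∞} [Fact (1 ≤ p)]

/-- For a symmetric basis of `ℓ_p`, `x ↦ (e*ₙ(x))` is an automorphism of `ℓ_p`. -/
theorem IsSymmetricBasis.exists_coordEquiv (hp_one : 1 < p) (hp_top : p ≠ ∞)
    {e : SchauderBasis ℂ (lp (fun _ : ℕ => ℂ) p)} (he : IsSymmetricBasis e) :
    ∃ S : lp (fun _ : ℕ => ℂ) p ≃L[ℂ] lp (fun _ : ℕ => ℂ) p, ∀ x n, S x n = e.coord n x := by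
  have hmem : ∀ x, Memℓp (fun n => e.coord n x) p := fun x =>
    (he.summable_iff_memℓp hp_one hp_top).1
      (he.summable_iff_conditional.1 (e.expansion x).summable)
  let S : lp (fun _ : ℕ => ℂ) p →ₗ[ℂ] lp (fun _ : ℕ => ℂ) p :=
    { toFun x := ⟨fun n => e.coord n x, hmem x⟩
      map_add' x y := by ext n; exact map_add _ _ _
      map_smul' a x := by ext n; exact map_smul _ _ _ }
  -- Both sides have continuous coordinates, so the graph of `S` is closed; the inverse is then
  -- bounded by the open mapping theorem.
  have hS : Continuous S := by
    refine S.continuous_of_seq_closed_graph fun u x y hu hSu => ?_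
    ext n
    have h1 := ((lp.evalCLM ℂ (fun _ : ℕ => ℂ) p n).continuous.tendsto y).comp hSu
    have h2 := ((e.coord n).continuous.tendsto x).comp hu
    exact tendsto_nhds_unique h1 h2
  have hinj : Function.Injective S := by
    rw [injective_iff_map_eq_zero]
    intro x hx
    have h0 : ∀ n, e.coord n x = 0 := fun n => congrFun (congrArg Subtype.val hx) n
    have h1 := e.expansion x
    simp only [h0, zero_smul] at h1
    exact h1.unique hasSum_zero
  have hsurj : Function.Surjective S := by
    intro d
    obtain ⟨x, hx⟩ := ((he.summable_iff_memℓp hp_one hp_top).2 (lp.memℓp d)).conditional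
    refine ⟨x, ?_⟩
    ext n
    exact e.coord_eq_of_hasSum hx n
  exact ⟨ContinuousLinearEquiv.ofBijective ⟨S, hS⟩ (LinearMap.ker_eq_bot.2 hinj)
    (LinearMap.range_eq_top.2 hsurj), fun x n => rfl⟩

end Coefficients

namespace FormalSpace

section General

variable {X : Type*} [NormedAddCommGroup X] [NormedSpace ℂ X] (b : SchauderBasis ℂ X) (k : ℕ)

theorem coeff_injective : Function.Injective (coeff b k) := Subtype.val_injective

theorem coord_toSum (x : FormalSpace b k) (n : ℕ) :
    b.coord n (toSum b k x) = (backwardDiff ^ k) (coeff b k x) n :=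
  b.coord_eq_of_hasSum (summable b k x).hasSum n

theorem toSum_surjective : Function.Surjective (toSum b k) := by
  intro x
  obtain ⟨c, hc⟩ := backwardDiff_pow_surjective k fun n => b.coord n x
  have h1 : HasSum (fun n => (backwardDiff ^ k) c n • b n) x (SummationFilter.conditional ℕ) := by
    rw [hc]
    exact b.expansion x
  exact ⟨⟨c, h1.summable⟩, h1.tsum_eq⟩

/-- The isometry between the space of formal series and the underlying Banach space. -/
def isometryEquiv : FormalSpace b k ≃ₗᵢ[ℂ] X :=
  LinearIsometryEquiv.ofSurjective ⟨toSum b k, fun _ => rfl⟩ (toSum_surjective b k)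

end General

/-- For a symmetric basis of `ℓ_p`, the space of formal series is isomorphic to `ℓ_p` via
`(𝔣) ∑ cₙ eₙ ↦ Δᵏ c`. -/
theorem exists_equiv_lp {p : ℝ≥0∞} [Fact (1 ≤ p)] (hp_one : 1 < p) (hp_top : p ≠ ∞)
    {e : SchauderBasis ℂ (lp (fun _ : ℕ => ℂ) p)} (he : IsSymmetricBasis e) (k : ℕ) :
    ∃ J : FormalSpace e k ≃L[ℂ] lp (fun _ : ℕ => ℂ) p,
      ∀ x n, J x n = (backwardDiff ^ k) (coeff e k x) n := by
  obtain ⟨S, hS⟩ := he.exists_coordEquiv hp_one hp_top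
  refine ⟨(isometryEquiv e k).toContinuousLinearEquiv.trans S, fun x n => ?_⟩
  rw [← coord_toSum]
  exact hS _ n

end FormalSpace

theorem continuous_backwardDiff : Continuous backwardDiff := by
  refine continuous_pi fun n => ?_
  cases n with
  | zero => simpa [backwardDiff_zero] using continuous_apply (A := fun _ : ℕ => ℂ) 0
  | succ n =>
    simp only [backwardDiff_succ]
    exact (continuous_apply _).sub (continuous_apply _)

theorem continuous_backwardDiff_pow (k : ℕ) : Continuous (backwardDiff ^ k) := by
  rw [Module.End.coe_pow]
  exact continuous_backwardDiff.iterate k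

/-- Each entry of a sequence is a finite combination of entries of its `k`-th difference. -/
theorem continuous_of_backwardDiff_pow {Z : Type*} [TopologicalSpace Z] (k : ℕ) {F : Z → ℕ → ℂ}
    (hF : ∀ n, Continuous fun z => (backwardDiff ^ k) (F z) n) (n : ℕ) :
    Continuous fun z => F z n := by
  induction k generalizing F n with
  | zero => simpa using hF n
  | succ k ih =>
    simp only [eq_sum_backwardDiff (F _) n]
    exact continuous_finsetSum _ fun i _ => ih (F := fun z => backwardDiff (F z))
      (fun j => by simpa [pow_succ] using hF j) i

/-! ### Bounded multipliers on the space of formal series. -/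

section Multipliers

variable {X : Type*} [NormedAddCommGroup X] [NormedSpace ℂ X] {b : SchauderBasis ℂ X} {k : ℕ}
  {p : ℝ≥0∞} [Fact (1 ≤ p)]

/-- The multipliers `m` which are bounded by `B` and satisfy `|mₙ₋ᵢ - mₙ| ≤ L n⁻ᵏ` for
`1 ≤ i ≤ k`. -/
structure IsMultiplier (k : ℕ) (B L : ℝ) (m : ℕ → ℂ) : Prop where
  norm_le : ∀ n, ‖m n‖ ≤ B
  norm_sub_le : ∀ n i : ℕ, 1 ≤ i → i ≤ k → i ≤ n → ‖m (n - i) - m n‖ ≤ L * ((n + 1 : ℝ) ^ k)⁻¹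

namespace FormalSpace

theorem mem_of_equiv {J : FormalSpace b k ≃L[ℂ] lp (fun _ : ℕ => ℂ) p}
    (hJ : ∀ x n, J x n = (backwardDiff ^ k) (coeff b k x) n) {c : ℕ → ℂ}
    (hc : Memℓp ((backwardDiff ^ k) c) p) : c ∈ formalSubmodule b k := by
  have h : coeff b k (J.symm ⟨_, hc⟩) = c := by
    apply backwardDiff_pow_injective k
    funext n
    rw [← hJ, J.apply_symm_apply]
  rw [← h]
  exact (J.symm ⟨_, hc⟩).2

theorem continuous_coeff {J : FormalSpace b k ≃L[ℂ] lp (fun _ : ℕ => ℂ) p}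
    (hJ : ∀ x n, J x n = (backwardDiff ^ k) (coeff b k x) n) (n : ℕ) :
    Continuous fun x => coeff b k x n := by
  refine continuous_of_backwardDiff_pow k (fun i => ?_) n
  simp only [← hJ]
  exact (lp.evalCLM ℂ (fun _ : ℕ => ℂ) p i).continuous.comp J.continuous

theorem exists_multiplierCLM (hp_one : 1 < p) (hp_top : p ≠ ∞) (hk : 1 ≤ k)
    {J : FormalSpace b k ≃L[ℂ] lp (fun _ : ℕ => ℂ) p}
    (hJ : ∀ x n, J x n = (backwardDiff ^ k) (coeff b k x) n) :
    ∃ C, 0 ≤ C ∧ ∀ (m : ℕ → ℂ) (B L : ℝ), 0 ≤ L → IsMultiplier k B L m →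
      ∃ T : FormalSpace b k →L[ℂ] FormalSpace b k,
        (∀ x n, coeff b k (T x) n = m n * coeff b k x n) ∧ ‖T‖ ≤ C * (B + L) := by
  have hp : 0 < p.toReal := ENNReal.toReal_pos (zero_lt_one.trans hp_one).ne' hp_top
  have hp0 : p ≠ 0 := (zero_lt_one.trans hp_one).ne'
  obtain ⟨C, hC, H⟩ := lp.exists_multiplier_bound hp_one hp_top hk
  refine ⟨‖(J.symm : lp (fun _ : ℕ => ℂ) p →L[ℂ] FormalSpace b k)‖ * ((1 + C) *
    ‖(J : FormalSpace b k →L[ℂ] lp (fun _ : ℕ => ℂ) p)‖), by positivity, fun m B L hL hm => ?_⟩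
  have hB : 0 ≤ B := (norm_nonneg _).trans (hm.norm_le 0)
  have hbound : ∀ x : FormalSpace b k, ∃ y : lp (fun _ : ℕ => ℂ) p,
      (∀ n, y n = (backwardDiff ^ k) (m * coeff b k x) n) ∧ ‖y‖ ≤ (1 + C) * (B + L) * ‖J x‖ := by
    intro x
    obtain ⟨h, hle, hb⟩ := H (J x) (coeff b k x) fun n => (hJ x n).symm
    let g : lp (fun _ : ℕ => ℝ) p := B • lp.toNorm (J x) + L • h
    have hg : ∀ n, ‖(backwardDiff ^ k) (m * coeff b k x) n‖ ≤ ‖g n‖ := fun n =>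
      (hb m B L hL hm.norm_le hm.norm_sub_le n).trans (le_abs_self _)
    have hmem : Memℓp ((backwardDiff ^ k) (m * coeff b k x)) p := (lp.memℓp g).mono' hg
    refine ⟨⟨_, hmem⟩, fun n => rfl, ?_⟩
    calc ‖(⟨_, hmem⟩ : lp (fun _ : ℕ => ℂ) p)‖ ≤ ‖g‖ := lp.norm_mono hp0 hg
      _ ≤ B * ‖J x‖ + L * (C * ‖J x‖) := by
        refine (norm_add_le _ _).trans ?_
        rw [norm_smul, norm_smul, Real.norm_of_nonneg hB, Real.norm_of_nonneg hL, lp.norm_toNorm]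
        gcongr
      _ ≤ (1 + C) * (B + L) * ‖J x‖ := by
        have h1 : 0 ≤ C * B * ‖J x‖ := by positivity
        have h2 : 0 ≤ L * ‖J x‖ := by positivity
        linarith
  have hmem : ∀ x : FormalSpace b k, m * coeff b k x ∈ formalSubmodule b k := by
    intro x
    obtain ⟨y, hy, -⟩ := hbound x
    apply mem_of_equiv hJ
    rw [← show (⇑y) = _ from funext hy]
    exact lp.memℓp y
  let T : FormalSpace b k →ₗ[ℂ] FormalSpace b k :=
    { toFun x := (⟨m * coeff b k x, hmem x⟩ : formalSubmodule b k)
      map_add' x y := by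
        apply coeff_injective
        exact mul_add m (coeff b k x) (coeff b k y)
      map_smul' a x := by
        apply coeff_injective
        exact mul_smul_comm a m (coeff b k x) }
  refine ⟨T.mkContinuous (‖(J.symm : lp (fun _ : ℕ => ℂ) p →L[ℂ] FormalSpace b k)‖ * ((1 + C) *
    ‖(J : FormalSpace b k →L[ℂ] lp (fun _ : ℕ => ℂ) p)‖) * (B + L)) fun x => ?_, fun x n => rfl,
    LinearMap.mkContinuous_norm_le _ (by positivity) _⟩
  obtain ⟨y, hy, hle⟩ := hbound x
  have hTx : T x = J.symm y := by
    rw [ContinuousLinearEquiv.eq_symm_apply]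
    ext n
    rw [hJ, hy]
    rfl
  rw [hTx]
  have h1 := (J.symm : lp (fun _ : ℕ => ℂ) p →L[ℂ] FormalSpace b k).le_opNorm y
  have h2 := (J : FormalSpace b k →L[ℂ] lp (fun _ : ℕ => ℂ) p).le_opNorm x
  calc ‖J.symm y‖ ≤ ‖(J.symm : lp (fun _ : ℕ => ℂ) p →L[ℂ] FormalSpace b k)‖ * ‖y‖ := h1
    _ ≤ ‖(J.symm : lp (fun _ : ℕ => ℂ) p →L[ℂ] FormalSpace b k)‖ * ((1 + C) * (B + L) *
        (‖(J : FormalSpace b k →L[ℂ] lp (fun _ : ℕ => ℂ) p)‖ * ‖x‖)) := by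
      gcongr
      refine hle.trans ?_
      gcongr
      exact h2
    _ = _ := by ring

/-- Common constants `B` and `L` give a common majorant in `ℓ_p`, so entrywise convergence of the
multipliers is enough, by dominated convergence. Strong continuity of the group rests on this. -/
theorem tendsto_of_isMultiplier (hp_one : 1 < p) (hp_top : p ≠ ∞) (hk : 1 ≤ k)
    {J : FormalSpace b k ≃L[ℂ] lp (fun _ : ℕ => ℂ) p}
    (hJ : ∀ x n, J x n = (backwardDiff ^ k) (coeff b k x) n) {ι : Type*} {l : Filter ι} [l.NeBot]
    {m : ι → ℕ → ℂ} {m' : ℕ → ℂ} {B L : ℝ} (hL : 0 ≤ L) (hm : ∀ᶠ i in l, IsMultiplier k B L (m i))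
    (hlim : ∀ n, Tendsto (fun i => m i n) l (𝓝 (m' n))) {x y' : FormalSpace b k}
    {y : ι → FormalSpace b k} (hy : ∀ i n, coeff b k (y i) n = m i n * coeff b k x n)
    (hy' : ∀ n, coeff b k y' n = m' n * coeff b k x n) : Tendsto y l (𝓝 y') := by
  have hp : 0 < p.toReal := ENNReal.toReal_pos (zero_lt_one.trans hp_one).ne' hp_top
  obtain ⟨C, hC, H⟩ := lp.exists_multiplier_bound hp_one hp_top hk
  obtain ⟨h, -, hb⟩ := H (J x) (coeff b k x) fun n => (hJ x n).symm
  have hJy : ∀ i, (coeff b k (y i)) = m i * coeff b k x := fun i => funext (hy i)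
  have key : Tendsto (fun i => J (y i)) l (𝓝 (J y')) := by
    refine lp.tendsto_of_dominated hp (g := fun n => (B • lp.toNorm (J x) + L • h :
      lp (fun _ : ℕ => ℝ) p) n) (lp.memℓp _) (hm.mono fun i hi n => ?_) fun n => ?_
    · rw [hJ, hJy]
      exact hb (m i) B L hL hi.norm_le hi.norm_sub_le n
    · simp only [hJ]
      have h1 : Tendsto (fun i => coeff b k (y i)) l (𝓝 (coeff b k y')) := by
        rw [tendsto_pi_nhds]
        intro j
        simp only [hy, hy']
        exact (hlim j).mul_const _
      exact tendsto_pi_nhds.1 (((continuous_backwardDiff_pow k).tendsto _).comp h1) n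
  have h2 := (J.symm.continuous.tendsto (J y')).comp key
  simpa [Function.comp_def] using h2

end FormalSpace

end Multipliers

/-! ### The multipliers `e^{itf}` and `(z - if)⁻¹`. -/

theorem Complex.norm_exp_I_mul_sub_le (x y : ℝ) :
    ‖Complex.exp (Complex.I * x) - Complex.exp (Complex.I * y)‖ ≤ |x - y| := by
  have h : Complex.exp (Complex.I * x) - Complex.exp (Complex.I * y) =
      Complex.exp (Complex.I * y) * (Complex.exp (Complex.I * ((x - y : ℝ) : ℂ)) - 1) := by
    rw [mul_sub, ← Complex.exp_add, mul_one]
    congr 2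
    push_cast
    ring
  rw [h, norm_mul, Complex.norm_exp_I_mul_ofReal, one_mul]
  exact Real.norm_exp_I_mul_ofReal_sub_one_le

/-- The condition on `f` that the class `𝒮ₖ` provides for the multipliers `e^{itf(n)}` and
`(z - i f(n))⁻¹`. -/
def HasDecayingDiff (k : ℕ) (L : ℝ) (f : ℝ → ℝ) : Prop :=
  ∀ n i : ℕ, 1 ≤ i → i ≤ k → i ≤ n →
    |f ((n - i : ℕ) + 1) - f (n + 1)| ≤ L * ((n + 1 : ℝ) ^ k)⁻¹

theorem IsClassS.exists_hasDecayingDiff {k : ℕ} {f : ℝ → ℝ} (hf : IsClassS k f) :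
    ∃ L, 0 ≤ L ∧ HasDecayingDiff k L f := by
  have h1 : ∀ j : ℕ, ∃ L : ℝ, 0 ≤ L ∧ (1 ≤ j → j ≤ k →
      ∀ n : ℕ, (n : ℝ) ^ k * |f ((n : ℝ) - j) - f n| ≤ L) := by
    intro j
    by_cases hj : 1 ≤ j ∧ j ≤ k
    · obtain ⟨l, hl⟩ := hf.2 j hj.1 hj.2
      obtain ⟨L, hL⟩ := hl.bddAbove_range
      have hb : ∀ n : ℕ, (n : ℝ) ^ k * |f ((n : ℝ) - j) - f n| ≤ L := fun n => hL ⟨n, rfl⟩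
      exact ⟨L, le_trans (by positivity) (hb 0), fun _ _ => hb⟩
    · exact ⟨0, le_rfl, fun h h' => absurd ⟨h, h'⟩ hj⟩
  choose L hL0 hL using h1
  refine ⟨∑ j ∈ Finset.range (k + 1), L j, Finset.sum_nonneg fun j _ => hL0 j, ?_⟩
  intro n i hi hik hin
  -- Entry `n` carries the argument `n + 1`, whence the shift; `i ≤ n` keeps `n + 1 - i` in `[1,
  -- ∞)`.
  have h2 := hL i hi hik (n + 1)
  have h3 : L i ≤ ∑ j ∈ Finset.range (k + 1), L j :=
    Finset.single_le_sum (f := L) (fun j _ => hL0 j) (by simp; omega)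
  have h4 : ((n + 1 : ℕ) : ℝ) - i = ((n - i : ℕ) : ℝ) + 1 := by
    rw [Nat.cast_sub hin]
    push_cast
    ring
  rw [h4] at h2
  push_cast at h2
  rw [← div_eq_mul_inv, le_div_iff₀ (by positivity), mul_comm]
  exact h2.trans h3

theorem HasDecayingDiff.isMultiplier_exp {k : ℕ} {L : ℝ} {f : ℝ → ℝ} (hf : HasDecayingDiff k L f)
    (t : ℝ) : IsMultiplier k 1 (|t| * L)
      (fun n : ℕ => Complex.exp (Complex.I * t * f (n + 1))) := by
  have h1 : ∀ n : ℕ, Complex.I * t * f (n + 1) = Complex.I * ((t * f (n + 1) : ℝ) : ℂ) := by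
    intro n
    push_cast
    ring
  simp only [h1]
  refine ⟨fun n => (Complex.norm_exp_I_mul_ofReal _).le, fun n i hi hik hin => ?_⟩
  refine (Complex.norm_exp_I_mul_sub_le _ _).trans ?_
  rw [← mul_sub, abs_mul, mul_assoc]
  exact mul_le_mul_of_nonneg_left (hf n i hi hik hin) (abs_nonneg t)

theorem abs_re_le_norm_sub_I_mul (z : ℂ) (r : ℝ) : |z.re| ≤ ‖z - Complex.I * r‖ := by
  simpa using Complex.abs_re_le_norm (z - Complex.I * r)

theorem HasDecayingDiff.isMultiplier_inv {k : ℕ} {L : ℝ} {f : ℝ → ℝ} (hf : HasDecayingDiff k L f)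
    {z : ℂ} (hz : z.re ≠ 0) : IsMultiplier k |z.re|⁻¹ (L * (|z.re|⁻¹ * |z.re|⁻¹))
      (fun n : ℕ => (z - Complex.I * f (n + 1))⁻¹) := by
  have hz0 : 0 < |z.re| := abs_pos.2 hz
  have hne : ∀ r : ℝ, z - Complex.I * r ≠ 0 := fun r =>
    norm_pos_iff.1 (hz0.trans_le (abs_re_le_norm_sub_I_mul z r))
  have hinv : ∀ r : ℝ, ‖(z - Complex.I * r)⁻¹‖ ≤ |z.re|⁻¹ := fun r => by
    rw [norm_inv]
    exact inv_anti₀ hz0 (abs_re_le_norm_sub_I_mul z r)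
  refine ⟨fun n => hinv _, fun n i hi hik hin => ?_⟩
  rw [inv_sub_inv (hne _) (hne _), div_eq_mul_inv, mul_inv, norm_mul, norm_mul]
  have h1 : ‖z - Complex.I * f (n + 1) - (z - Complex.I * f ((n - i : ℕ) + 1))‖ =
      |f ((n - i : ℕ) + 1) - f (n + 1)| := by
    have : z - Complex.I * f (n + 1) - (z - Complex.I * f ((n - i : ℕ) + 1)) =
        Complex.I * ((f ((n - i : ℕ) + 1) - f (n + 1) : ℝ) : ℂ) := by
      push_cast
      ring
    rw [this, norm_mul, Complex.norm_I, one_mul, Complex.norm_real, Real.norm_eq_abs]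
  rw [h1]
  have h2 : 0 ≤ L * ((n + 1 : ℝ) ^ k)⁻¹ := (abs_nonneg _).trans (hf n i hi hik hin)
  calc _ ≤ L * ((n + 1 : ℝ) ^ k)⁻¹ * (|z.re|⁻¹ * |z.re|⁻¹) := by
        gcongr
        · exact hf n i hi hik hin
        · exact hinv _
        · exact hinv _
    _ = _ := by ring

/-! ### Generator, growth bound and spectrum. -/

namespace FormalSpace

section Group

variable {X : Type*} [NormedAddCommGroup X] [NormedSpace ℂ X] {b : SchauderBasis ℂ X} {k : ℕ}
  {f : ℝ → ℝ}

theorem single_mem (b : SchauderBasis ℂ X) (k : ℕ) (j : ℕ) :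
    (Pi.single j 1 : ℕ → ℂ) ∈ formalSubmodule b k := by
  have h1 : ∀ k n, j + k < n → (backwardDiff ^ k) (Pi.single j 1 : ℕ → ℂ) n = 0 := by
    intro k
    induction k with
    | zero =>
      intro n hn
      have : n ≠ j := by omega
      simp [this]
    | succ k ih =>
      intro n hn
      obtain ⟨n, rfl⟩ := Nat.exists_eq_add_of_le' (show 1 ≤ n by omega)
      rw [pow_succ', Module.End.mul_apply, backwardDiff_succ, ih _ (by omega), ih _ (by omega),
        sub_zero]
  have h2 : Summable fun n => (backwardDiff ^ k) (Pi.single j 1 : ℕ → ℂ) n • b n := by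
    apply summable_of_ne_finset_zero (s := Finset.range (j + k + 1))
    intro n hn
    rw [h1 k n (by simpa using hn), zero_smul]
  exact h2.conditional

/-- The formal series with a single coefficient `1`. -/
def single (b : SchauderBasis ℂ X) (k : ℕ) (j : ℕ) : FormalSpace b k :=
  (⟨Pi.single j 1, single_mem b k j⟩ : formalSubmodule b k)

theorem coeff_single (j : ℕ) : coeff b k (single b k j) = Pi.single j 1 := rfl

/-- The domain is maximal: `(f(n + 1) cₙ)` is `-i` times the coefficient sequence of `y`, hence lies
in the space. Statements about the operator become identities of coefficients. -/
theorem mem_graph_multOp_iff (x y : FormalSpace b k) :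
    (x, y) ∈ (multOp b k f).graph ↔
      ∀ n, coeff b k y n = Complex.I * f (n + 1) * coeff b k x n := by
  rw [LinearPMap.mem_graph_iff]
  constructor
  · rintro ⟨x', rfl, rfl⟩ n
    exact coeff_multOp b k f x' n
  · intro h
    have hx : x ∈ (multOp b k f).domain := by
      have h1 : (fun n : ℕ => (f (n + 1) : ℂ) * coeff b k x n) = -Complex.I • coeff b k y := by
        funext n
        rw [Pi.smul_apply, h, smul_eq_mul]
        linear_combination ((f (n + 1) : ℂ) * coeff b k x n) * Complex.I_sq
      change (fun n : ℕ => (f (n + 1) : ℂ) * coeff b k x n) ∈ formalSubmodule b k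
      rw [h1]
      exact (formalSubmodule b k).smul_mem _ y.2
    refine ⟨⟨x, hx⟩, rfl, ?_⟩
    apply coeff_injective
    funext n
    rw [coeff_multOp, h]

variable {U : C0Group (FormalSpace b k)}

/-- The group of multipliers `e^{itf(n)}` is generated by the multiplication operator `i f(n)`. -/
theorem hasGenerator_multOp [CompleteSpace X]
    (hcoeff : ∀ n, Continuous fun x : FormalSpace b k => coeff b k x n)
    (hU : ∀ (t : ℝ) (x : FormalSpace b k) (n : ℕ), coeff b k (U.op t x) n =
      Complex.exp (Complex.I * t * f (n + 1)) * coeff b k x n) :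
    U.HasGenerator (multOp b k f) := by
  have : CompleteSpace (FormalSpace b k) :=
    (completeSpace_congr (e := (isometryEquiv b k).toEquiv)
      (isometryEquiv b k).isometry.isUniformEmbedding).2 inferInstance
  have hderiv : ∀ (n : ℕ) (s : ℝ), HasDerivAt (fun s : ℝ => Complex.exp (Complex.I * s * f (n + 1)))
      (Complex.exp (Complex.I * s * f (n + 1)) * (Complex.I * f (n + 1))) s := by
    intro n s
    have h1 : HasDerivAt (fun s : ℝ => Complex.I * s * f (n + 1)) (Complex.I * f (n + 1)) s := by
      simpa using ((Complex.ofRealCLM.hasDerivAt (x := s)).const_mul Complex.I).mul_const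
        (f (n + 1) : ℂ)
    exact h1.cexp
  intro x y
  rw [mem_graph_multOp_iff]
  constructor
  · intro hxy
    -- The integral form of `u' = Au` holds in each coefficient, hence in the space; differentiating
    -- it at `0` gives the limit in norm.
    have hint : ∀ h : ℝ, U.op h x - x = ∫ s in (0 : ℝ)..h, U.op s y := by
      intro h
      apply coeff_injective
      funext n
      let ℓ : FormalSpace b k →L[ℂ] ℂ :=
        ⟨(LinearMap.proj n : (ℕ → ℂ) →ₗ[ℂ] ℂ).comp (coeff b k), hcoeff n⟩
      have h1 : coeff b k (∫ s in (0 : ℝ)..h, U.op s y) n =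
          ∫ s in (0 : ℝ)..h, coeff b k (U.op s y) n :=
        (ℓ.intervalIntegral_comp_comm ((U.continuous_orbit y).intervalIntegrable 0 h)).symm
      have h2 := intervalIntegral.integral_eq_sub_of_hasDerivAt
        (f := fun s : ℝ => Complex.exp (Complex.I * s * f (n + 1)) * coeff b k x n)
        (f' := fun s : ℝ => coeff b k (U.op s y) n) (a := 0) (b := h) (fun s _ => by
          rw [hU, hxy, ← mul_assoc]
          exact (hderiv n s).mul_const _)
        (((hcoeff n).comp (U.continuous_orbit y)).intervalIntegrable 0 h)
      rw [h1, h2, map_sub, Pi.sub_apply, hU]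
      simp
    have h3 := intervalIntegral.integral_hasDerivAt_right
      ((U.continuous_orbit y).intervalIntegrable 0 0)
      ((U.continuous_orbit y).stronglyMeasurableAtFilter _ _)
      (U.continuous_orbit y).continuousAt
    rw [hasDerivAt_iff_tendsto_slope_zero] at h3
    simp only [zero_add, intervalIntegral.integral_same, sub_zero, ← hint, U.op_zero] at h3
    refine h3.congr fun h => ?_
    rw [← Complex.ofReal_inv, Complex.coe_smul]
  · intro hlim n
    have h1 := ((hcoeff n).tendsto y).comp hlim
    have h2 := ((hasDerivAt_iff_tendsto_slope_zero.1 (hderiv n 0))).mul_const (coeff b k x n)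
    refine (tendsto_nhds_unique h1 (h2.congr fun h => ?_)).trans ?_
    · simp only [Function.comp, map_smul, map_sub, Pi.smul_apply, Pi.sub_apply, hU, zero_add,
        Complex.real_smul, smul_eq_mul]
      push_cast
      simp
      ring
    · simp

/-- Exponential decay would drive the orbit of a unit vector to `0`, but its nonzero coefficient
keeps modulus `1`. -/
theorem zero_le_growthBound (hcoeff : ∀ n, Continuous fun x : FormalSpace b k => coeff b k x n)
    (hU : ∀ (t : ℝ) (x : FormalSpace b k) (n : ℕ), coeff b k (U.op t x) n =
      Complex.exp (Complex.I * t * f (n + 1)) * coeff b k x n) :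
    0 ≤ U.growthBound := by
  refine le_sInf ?_
  rintro _ ⟨w, ⟨M, hM⟩, rfl⟩
  rw [EReal.coe_nonneg]
  by_contra! hw
  let x := single b k 0
  have h1 : Tendsto (fun t : ℝ => M * Real.exp (w * t) * ‖x‖) atTop (𝓝 0) := by
    have h2 : Tendsto (fun t : ℝ => w * t) atTop atBot := tendsto_id.const_mul_atTop_of_neg hw
    simpa using ((Real.tendsto_exp_atBot.comp h2).const_mul M).mul_const ‖x‖
  have h2 : Tendsto (fun t => U.op t x) atTop (𝓝 0) :=
    squeeze_zero_norm' ((eventually_ge_atTop 0).mono fun t ht => ((U.op t).le_opNorm x).trans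
      (mul_le_mul_of_nonneg_right (hM t ht) (norm_nonneg _))) h1
  have h3 := (((hcoeff 0).tendsto 0).comp h2).norm
  have h4 : ∀ t : ℝ, ‖coeff b k (U.op t x) 0‖ = 1 := by
    intro t
    rw [hU, norm_mul, coeff_single, Pi.single_eq_same, norm_one, mul_one,
      show Complex.I * t * f ((0 : ℕ) + 1) = Complex.I * ((t * f ((0 : ℕ) + 1) : ℝ) : ℂ) by
        push_cast; ring, Complex.norm_exp_I_mul_ofReal]
  simp only [Function.comp_def, h4, map_zero, Pi.zero_apply, norm_zero] at h3
  exact one_ne_zero (tendsto_nhds_unique tendsto_const_nhds h3)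

/-- For each `w > 0`, linear growth is absorbed: `1 + t ≤ (1 + w⁻¹) e^{wt}`. -/
theorem growthBound_le_zero {C : ℝ} (hC : ∀ t : ℝ, 0 ≤ t → ‖U.op t‖ ≤ C * (1 + t)) :
    U.growthBound ≤ 0 := by
  have hC0 : 0 ≤ C := by
    have := (norm_nonneg _).trans (hC 0 le_rfl)
    simpa using this
  refine EReal.le_of_forall_lt_iff_le.1 fun w hw => sInf_le ⟨w, ⟨C * (1 + w⁻¹), fun t ht => ?_⟩, rfl⟩
  have hw0 : 0 < w := EReal.coe_pos.1 hw
  have h1 : 1 ≤ Real.exp (w * t) := Real.one_le_exp (by positivity)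
  have h2 : w * t ≤ Real.exp (w * t) := by linarith [Real.add_one_le_exp (w * t)]
  have h3 : t ≤ w⁻¹ * Real.exp (w * t) := by
    rwa [le_inv_mul_iff₀ hw0]
  rw [mul_assoc]
  refine (hC t ht).trans (mul_le_mul_of_nonneg_left ?_ hC0)
  linarith

/-- The series with the single coefficient `1` at `n` is an eigenvector, which a left inverse would
have to recover from `0`. -/
theorem I_mul_mem_unboundedSpectrum (n : ℕ) :
    Complex.I * f (n + 1) ∈ unboundedSpectrum (multOp b k f) := by
  rintro ⟨R, -, hR⟩
  have h1 : (single b k n, (Complex.I * f (n + 1)) • single b k n) ∈ (multOp b k f).graph := by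
    rw [mem_graph_multOp_iff]
    intro i
    rw [map_smul, Pi.smul_apply, coeff_single, smul_eq_mul]
    rcases eq_or_ne i n with rfl | hi
    · rfl
    · simp [hi]
  obtain ⟨x, hx, hAx⟩ := (LinearPMap.mem_graph_iff _).1 h1
  have h2 := hR x
  simp only at hx hAx
  rw [hAx, hx, sub_self, map_zero] at h2
  have h3 := congrFun (congrArg (coeff b k) h2) n
  simp [coeff_single] at h3

theorem mem_unboundedResolventSet {z : ℂ} {R : FormalSpace b k →L[ℂ] FormalSpace b k}
    (hz : ∀ n : ℕ, z - Complex.I * f (n + 1) ≠ 0)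
    (hR : ∀ x n, coeff b k (R x) n = (z - Complex.I * f (n + 1))⁻¹ * coeff b k x n) :
    z ∈ unboundedResolventSet (multOp b k f) := by
  refine ⟨R, fun y => ?_, fun x => ?_⟩
  · have h1 : (R y, z • R y - y) ∈ (multOp b k f).graph := by
      rw [mem_graph_multOp_iff]
      intro n
      simp only [map_sub, map_smul, Pi.sub_apply, Pi.smul_apply, smul_eq_mul, hR]
      linear_combination coeff b k y n * (mul_inv_cancel₀ (hz n))
    obtain ⟨x, hx, hAx⟩ := (LinearPMap.mem_graph_iff _).1 h1
    simp only at hx hAx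
    have hmem : R y ∈ (multOp b k f).domain := hx ▸ x.2
    have hx' : x = ⟨R y, hmem⟩ := Subtype.ext hx
    refine ⟨hmem, ?_⟩
    rw [← hx', hAx]
    abel
  · apply coeff_injective
    funext n
    rw [hR, map_sub, map_smul, Pi.sub_apply, Pi.smul_apply, smul_eq_mul, coeff_multOp, ← sub_mul,
      inv_mul_cancel_left₀ (hz n)]

theorem spectralBound_multOp_eq_zero
    (hres : ∀ z : ℂ, 0 < z.re → z ∈ unboundedResolventSet (multOp b k f)) :
    spectralBound (multOp b k f) = 0 := by
  apply le_antisymm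
  · refine sSup_le ?_
    rintro _ ⟨z, hz, rfl⟩
    rw [EReal.coe_nonpos]
    by_contra! h
    exact hz (hres z h)
  · refine le_sSup ⟨_, I_mul_mem_unboundedSpectrum 0, ?_⟩
    simp

end Group

end FormalSpace

/-! ### Assembly of the group. -/

theorem corollary3 (p : ℝ≥0∞) [Fact (1 ≤ p)] (hp_one : 1 < p) (hp_top : p ≠ ∞)
    (e : SchauderBasis ℂ (lp (fun _ : ℕ => ℂ) p)) (he : IsSymmetricBasis e)
    (k : ℕ) (hk : 1 ≤ k) (f : ℝ → ℝ) (hf : IsClassS k f) :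
    ∃ U : C0Group (FormalSpace e k),
      U.HasGenerator (FormalSpace.multOp e k f) ∧
      (∀ (t : ℝ) (x : FormalSpace e k) (n : ℕ),
        FormalSpace.coeff e k (U.op t x) n =
          Complex.exp (Complex.I * t * f (n + 1)) * FormalSpace.coeff e k x n) ∧
      U.growthBound = spectralBound (FormalSpace.multOp e k f) ∧
      spectralBound (FormalSpace.multOp e k f) = 0 := by
  obtain ⟨L, hL, hfL⟩ := hf.exists_hasDecayingDiff
  obtain ⟨J, hJ⟩ := FormalSpace.exists_equiv_lp hp_one hp_top he k
  obtain ⟨C, hC, H⟩ := FormalSpace.exists_multiplierCLM hp_one hp_top hk hJ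
  have hcoeff := FormalSpace.continuous_coeff hJ
  choose V hV hVle using fun t : ℝ => H _ _ _ (by positivity) (hfL.isMultiplier_exp t)
  let U : C0Group (FormalSpace e k) :=
    { op := V
      op_zero := by
        ext x
        apply FormalSpace.coeff_injective
        funext n
        simp [hV]
      op_add := fun s t => by
        ext x
        apply FormalSpace.coeff_injective
        funext n
        rw [ContinuousLinearMap.comp_apply, hV, hV, hV, ← mul_assoc, ← Complex.exp_add]
        congr 2
        push_cast
        ring
      continuous_orbit := fun x => continuous_iff_continuousAt.2 fun t => by
        -- Only `s` with `|s| < |t| + 1` matter near `t`; this gives the common constant `(|t| + 1)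
        -- * L`.
        refine FormalSpace.tendsto_of_isMultiplier hp_one hp_top hk hJ
          (m := fun (s : ℝ) (n : ℕ) => Complex.exp (Complex.I * s * f (n + 1)))
          (m' := fun n : ℕ => Complex.exp (Complex.I * t * f (n + 1)))
          (B := 1) (L := (|t| + 1) * L) (by positivity) ?_ (fun n => ?_) (fun s => hV s x) (hV t x)
        · filter_upwards [continuous_abs.continuousAt.eventually_lt
            (continuousAt_const (y := |t| + 1)) (lt_add_one |t|)] with s hs
          refine ⟨(hfL.isMultiplier_exp s).norm_le, fun n i hi hik hin =>
            ((hfL.isMultiplier_exp s).norm_sub_le n i hi hik hin).trans ?_⟩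
          gcongr
        · exact Continuous.tendsto (by fun_prop) t }
  have hU : ∀ (t : ℝ) (x : FormalSpace e k) (n : ℕ), FormalSpace.coeff e k (U.op t x) n =
      Complex.exp (Complex.I * t * f (n + 1)) * FormalSpace.coeff e k x n := hV
  have hspec : spectralBound (FormalSpace.multOp e k f) = 0 := by
    refine FormalSpace.spectralBound_multOp_eq_zero fun z hz => ?_
    obtain ⟨R, hR, -⟩ := H _ _ _ (by positivity) (hfL.isMultiplier_inv hz.ne')
    exact FormalSpace.mem_unboundedResolventSet (fun n => norm_pos_iff.1
      ((abs_pos.2 hz.ne').trans_le (abs_re_le_norm_sub_I_mul z (f (n + 1))))) hR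
  refine ⟨U, FormalSpace.hasGenerator_multOp hcoeff hU, hU, ?_, hspec⟩
  rw [hspec]
  refine le_antisymm (FormalSpace.growthBound_le_zero (C := C * (1 + L)) fun t ht => ?_)
    (FormalSpace.zero_le_growthBound hcoeff hU)
  -- What remains is `1 + tL ≤ (1 + L)(1 + t)`.
  refine (hVle t).trans ?_
  rw [abs_of_nonneg ht, mul_assoc]
  gcongr
  nlinarith

end
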